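/- Let $\mathcal X$ be a finite alphabet, $\mathcal H_B$ a finite-dimensional Hilbert space, $p_X$ a probability distribution on $\mathcal X$ and $\{\rho_B^x\}_{x\in\mathcal X}$ density operators on $\mathcal H_B$; put $\rho_{XB}=\sum_x p_X(x)\,|x\rangle\langle x|\otimes\rho_B^x$. POVMs are written $\Pi_{XB}=\sum_x|x\rangle\langle x|\otimes\Pi_B^x$ with $\Pi_B^x\ge 0$ and $\sum_x\Pi_B^x=\mathbb 1_B$. For $\alpha\in(1,\infty]$ (with $\frac{\alpha-1}{\alpha}=1$ for $\alpha=\infty$) the $\alpha$-leakage is $$\mathcal L_\alpha(X\to B)_\rho=\frac{\alpha}{\alpha-1}\log\frac{\sup_{\Pi_{XB}}\operatorname{Tr}\big[\rho_{XB}\,\Pi_{XB}^{(\alpha-1)/\alpha}\big]}{\sup_{q}\sum_x p_X(x)\,q(x)^{(\alpha-1)/\alpha}},$$ where $\Pi_{XB}$ ranges over POVMs and $q$ over probability distributions on $\mathcal X$. For $\alpha=1$, $$\mathcal L_1(X\to B)_\rho=\varepsilon_1(X)-\varepsilon_1(X|B),\qquad \varepsilon_1(X|B)=\inf_{\Pi_{XB}}-\operatorname{Tr}[\rho_{XB}\log\Pi_{XB}],\qquad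 \varepsilon_1(X)=\inf_q-\sum_xp_X(x)\log q(x),$$ where the objective is $+\infty$ unless $\operatorname{supp}\rho_{XB}\subseteq\operatorname{supp}\Pi_{XB}$ (respectively $\operatorname{supp}p_X\subseteq\operatorname{supp}q$). The maximal $\alpha$-leakage is $\mathcal L_\alpha^{\max}(X\to B)_\rho=\sup_{p_{S|X}}\mathcal L_\alpha(S\to B)_\rho$, the supremum being over all conditional distributions $p_{S|X}$ of a variable $S$ with values in an arbitrary finite alphabet, such that $S-X-B$ is a Markov chain, i.e. $\rho_{SB}=\sum_{s,x}p_{S|X}(s|x)p_X(x)\,|s\rangle\langle s|\otimes\rho_B^x$. **Theorem.** For all $\alpha\in[1,\infty]$: 1. For fixed $\{\rho_B^x\}_{x}$, $\mathcal L_\alpha^{\max}(X\to B)_\rho$ is a concave function of $p_X$. 2. For fixed $p_X$, $\mathcal L_\alpha^{\max}(X\to B)_\rho$ is a (jointly) quasi-convex function of the family of states $\{\rho_B^x\}_{x}$. 3. For fixed $\rho_{XB}$, $\mathcal L_\alpha^{\max}(X\to B)_\rho$ is non-decreasing in $\alpha\in[1,\infty]$. 4. (Data processing.) Let $S-X-B$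 be a classical-classical-quantum Markov chain, that is, $\rho_{SXB}=\sum_{s,x}p_{SX}(s,x)\,|s\rangle\langle s|\otimes|x\rangle\langle x|\otimes\rho_B^x$ with $S$ and $X$ in finite alphabets. Then $$\mathcal L_\alpha^{\max}(S\to B)_\rho\le\mathcal L_\alpha^{\max}(X\to B)_\rho\quad\text{and}\quad\mathcal L_\alpha^{\max}(S\to B)_\rho\le\mathcal L_\alpha^{\max}(S\to X)_\rho,$$ where in $\mathcal L_\alpha^{\max}(S\to X)_\rho$ the classical register $X$ plays the role of the observed (quantum) system. 5. $0\le\mathcal L_\alpha^{\max}(X\to B)_\rho\le\log|\operatorname{supp}(p_X)|$, and $\mathcal L_1^{\max}(X\to B)_\rho\le H(X)$, the Shannon entropy of $p_X$. -/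

import Mathlib

open scoped ENNReal ComplexOrder

noncomputable section

namespace QLeakage

/-- `ρ` is a quantum state (density matrix) of the finite-dimensional system with index set `d`. -/
def IsState {d : Type*} [Fintype d] (ρ : Matrix d d ℂ) : Prop :=
  ρ.PosSemidef ∧ ρ.trace = 1

/-- `M` is a POVM with outcomes in `X`: positive semidefinite matrices that sum to the identity. -/
def IsPOVM {X d : Type*} [Fintype X] [Fintype d] [DecidableEq d]
    (M : X → Matrix d d ℂ) : Prop :=
  (∀ x, (M x).PosSemidef) ∧ ∑ x, M x = 1

/-- A classical-quantum state `∑ x, |x⟩⟨x| ⊗ τ x` is recorded by its (unnormalised) blocks `τ x`.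
These are the blocks `p x • ρ x` of the state `∑ x, p x |x⟩⟨x| ⊗ ρ x`. -/
def cqBlocks {X d : Type*} (p : X → ℝ) (ρ : X → Matrix d d ℂ) : X → Matrix d d ℂ :=
  fun x => p x • ρ x

/-- The distribution of the classical register: `p x = Tr (τ x)`. -/
def classicalMarginal {X d : Type*} [Fintype d] (τ : X → Matrix d d ℂ) : X → ℝ :=
  fun x => (τ x).trace.re

/-- The blocks `∑ x, W(s|x) τ x` of the state of `S` and `B` when `S` is drawn from `X` by the
conditional distribution `W`, so that `S - X - B` is a Markov chain. -/
def relabel {X S d : Type*} [Fintype X] (W : X → S → ℝ) (τ : X → Matrix d d ℂ) :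
    S → Matrix d d ℂ :=
  fun s => ∑ x, W x s • τ x

/-- The exponent `(α - 1) / α`, with value `1` at `α = ∞`. -/
def gainExponent (α : ℝ≥0∞) : ℝ :=
  if α = ∞ then 1 else (α.toReal - 1) / α.toReal

/-- The expected gain `Tr[ρ_XB Π_XB ^ s]` of the POVM `M`, where `ρ_XB = ∑ x, |x⟩⟨x| ⊗ τ x` and
`Π_XB = ∑ x, |x⟩⟨x| ⊗ M x` are block diagonal matrices; the power is the functional calculus. -/
def expectedGain {X d : Type*} [Fintype X] [DecidableEq X] [Fintype d] [DecidableEq d]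
    (s : ℝ) (τ M : X → Matrix d d ℂ) : ℝ :=
  (Matrix.blockDiagonal τ * cfc (fun t : ℝ => t ^ s) (Matrix.blockDiagonal M)).trace.re

/-- The maximal expected gain `P_α(X|B)`, a supremum over all POVMs on `B` with outcomes in `X`. -/
def maxGain {X d : Type*} [Fintype X] [DecidableEq X] [Fintype d] [DecidableEq d]
    (s : ℝ) (τ : X → Matrix d d ℂ) : ℝ :=
  ⨆ M : {M : X → Matrix d d ℂ // IsPOVM M}, expectedGain s τ M.1

/-- The maximal expected gain `P_α(X)` without any observation. -/
def priorGain {X : Type*} [Fintype X] (s : ℝ) (p : X → ℝ) : ℝ :=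
  ⨆ q : stdSimplex ℝ X, ∑ x, p x * (q : X → ℝ) x ^ s

open Classical in
/-- The expected log-loss `-Tr[ρ_XB log Π_XB]` if `supp ρ_XB ⊆ supp Π_XB` (for Hermitian matrices:
`ker Π_XB ⊆ ker ρ_XB`), and `+∞` otherwise. The logarithm acts on the support of `Π_XB`. -/
def expectedLogLoss {X d : Type*} [Fintype X] [DecidableEq X] [Fintype d] [DecidableEq d]
    (τ M : X → Matrix d d ℂ) : EReal :=
  if LinearMap.ker (Matrix.blockDiagonal M).mulVecLin ≤
      LinearMap.ker (Matrix.blockDiagonal τ).mulVecLin then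
    ((-(Matrix.blockDiagonal τ * cfc Real.log (Matrix.blockDiagonal M)).trace.re : ℝ) : EReal)
  else ⊤

/-- The minimal expected log-loss `ε_1(X|B)`. -/
def minLogLoss {X d : Type*} [Fintype X] [DecidableEq X] [Fintype d] [DecidableEq d]
    (τ : X → Matrix d d ℂ) : EReal :=
  ⨅ M : {M : X → Matrix d d ℂ // IsPOVM M}, expectedLogLoss τ M.1

open Classical in
/-- The minimal expected log-loss `ε_1(X)` without any observation. -/
def priorLogLoss {X : Type*} [Fintype X] (p : X → ℝ) : EReal :=
  ⨅ q : stdSimplex ℝ X,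
    if ∀ x, (q : X → ℝ) x = 0 → p x = 0 then
      ((-∑ x, p x * Real.log ((q : X → ℝ) x) : ℝ) : EReal)
    else ⊤

open Classical in
/-- The `α`-leakage `L_α(X → B)`: `α/(α-1) · log (P_α(X|B) / P_α(X))` for `α ∈ (1, ∞]`, and
`ε_1(X) - ε_1(X|B)` for `α = 1`. -/
def leakage {X d : Type*} [Fintype X] [DecidableEq X] [Fintype d] [DecidableEq d]
    (α : ℝ≥0∞) (τ : X → Matrix d d ℂ) : EReal :=
  if α = 1 then priorLogLoss (classicalMarginal τ) - minLogLoss τ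
  else (((gainExponent α)⁻¹ *
    Real.log (maxGain (gainExponent α) τ /
      priorGain (gainExponent α) (classicalMarginal τ)) : ℝ) : EReal)

/-- The maximal `α`-leakage `L_α^max(X → B)`: the supremum of `L_α(S → B)` over all Markov chains
`S - X - B` with `S` in a finite alphabet. -/
def maxLeakage {X d : Type*} [Fintype X] [Fintype d] [DecidableEq d]
    (α : ℝ≥0∞) (τ : X → Matrix d d ℂ) : EReal :=
  ⨆ (n : ℕ) (W : {W : X → Fin n → ℝ // ∀ x, W x ∈ stdSimplex ℝ (Fin n)}),
    leakage α (relabel W.1 τ)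

/-- Shannon entropy (natural logarithm). -/
def shannonEntropy {X : Type*} [Fintype X] (p : X → ℝ) : ℝ :=
  ∑ x, Real.negMulLog (p x)

end QLeakage

end

namespace QLeakage

open scoped MatrixOrder Matrix.Norms.L2Operator

/-! Write `a = (α - 1) / α`. Most of the theorem rests on closed formulas from which the auxiliary
variable `S` has disappeared. For `α > 1` the maximal leakage is `a⁻¹ log C`, where `C` is the
supremum of `∑ r(x)^(1-a) Tr[ρ_x M_x^a]` over distributions `r` and POVMs `M` that vanish off `supp
p` (`maxLeakage_eq_log_gainCapacity`). For `α = 1` it is the supremum of `∑ p(x) (Tr[ρ_x log M_x] -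
log p(x))` over POVMs that are positive definite on `supp p` and vanish off it
(`maxLeakage_one_eq_logCapacity`).

Upper bound (`sum_gain_le`, `sum_log_le`): the equality case of Hölder's inequality gives a
distribution `r` on `S` with `P(s) ≤ (prior gain) * r(s)^(1-a)`. Averaging `r` and the POVM over the
posterior of `X` given `s` produces a strategy on `X`. The averaging does not lower the value,
because `(r, B) ↦ r^(1-a) Tr[ρ B^a]` is the perspective of an operator concave function, hence
superadditive. For `α = 1` the operator logarithm plays the same role and no `r` is needed.

Lower bound: for `α > 1`, each `x` is split into many equally informative parts whose probabilities
are tuned so that the prior gain is at most a constant `c` while the gain is at least `c` times the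
tilted gain (`IsStrategy.exists_refinement`). For `α = 1`, `S = X` suffices.

The five claims can then be read off. For `α > 1` the capacity depends on `p` only through its
support and grows with it, which gives concavity; for `α = 1` superadditivity gives it. Suprema of
functions affine in `ρ` are convex, and the logarithm of a convex function is quasi-convex. Power
means give monotonicity in `α`. Data processing is composition of channels on one side, and on the
other Jensen's inequality `Tr[σ M^a] ≤ Tr[σ M]^a`, which replaces a measurement of `B` by one of
`X`. The upper bounds estimate each summand; the strategy `M_x = p(x) 1` gives the lower bound. -/

lemma posSemidef_real_smul {d : Type*} {A : Matrix d d ℂ} (hA : A.PosSemidef) {c : ℝ}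
    (hc : 0 ≤ c) : (c • A).PosSemidef := hA.smul hc

lemma posDef_real_smul {d : Type*} {A : Matrix d d ℂ} (hA : A.PosDef) {c : ℝ} (hc : 0 < c) :
    (c • A).PosDef := hA.smul hc

/-! ### Trace inequalities and operator concavity of powers and the logarithm. -/

section Spectral

variable {d : Type*} [Fintype d] [DecidableEq d]

/-- In the eigenbasis of `M`, a positive semidefinite `A` defines nonnegative weights that
represent `f ↦ Tr[A f(M)]`. -/
lemma exists_spectral_weights {A M : Matrix d d ℂ} (hA : A.PosSemidef) (hM : M.IsHermitian) :
    ∃ w : d → ℝ, (∀ i, 0 ≤ w i) ∧ ∑ i, w i = A.trace.re ∧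
      (∀ f : ℝ → ℝ, (A * cfc f M).trace.re = ∑ i, w i * f (hM.eigenvalues i)) ∧
      (LinearMap.ker M.mulVecLin ≤ LinearMap.ker A.mulVecLin →
        ∀ i, hM.eigenvalues i = 0 → w i = 0) := by
  set U : Matrix d d ℂ := (hM.eigenvectorUnitary : Matrix d d ℂ) with hU
  -- With `M = U D U*`, cyclicity of the trace leaves only the diagonal of `U* A U` paired with
  -- `f(D)`.
  have key : ∀ f : ℝ → ℝ, (A * cfc f M).trace.re =
      ∑ i, ((star U * A * U) i i).re * f (hM.eigenvalues i) := by
    intro f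
    rw [hM.cfc_eq, Matrix.IsHermitian.cfc, Unitary.conjStarAlgAut_apply, ← hU, mul_assoc,
      ← mul_assoc A, Matrix.trace_mul_comm, mul_assoc, Matrix.trace_mul_comm, ← mul_assoc,
      Matrix.trace, Complex.re_sum]
    refine Finset.sum_congr rfl fun i _ => ?_
    simp [Matrix.diag, Matrix.mul_diagonal]
  have hpos : (star U * A * U).PosSemidef := hA.conjTranspose_mul_mul_same U
  refine ⟨fun i => ((star U * A * U) i i).re, fun i => ?_, ?_, key, ?_⟩
  · exact (Complex.le_def.1 (hpos.diag_nonneg (i := i))).1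
  · have := key (fun _ => 1)
    rw [cfc_const_one ℝ M hM.isSelfAdjoint] at this
    simpa using this.symm
  -- An eigenvector for the eigenvalue `0` lies in `ker M`, hence in `ker A`, so its weight
  -- vanishes.
  · intro hker i hi
    have h1 : M.mulVec (U.col i) = 0 := by
      have := hM.mulVec_eigenvectorBasis i
      rw [hi, zero_smul] at this
      rw [← this]
      congr 1
    have h2 : A.mulVec (U.col i) = 0 := by
      have : U.col i ∈ LinearMap.ker A.mulVecLin := hker (by simpa using h1)
      simpa using this
    have h3 : (A * U).mulVec (Pi.single i 1) = 0 := by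
      rw [← Matrix.mulVec_mulVec, Matrix.mulVec_single_one, h2]
    have h4 : (star U * A * U) i i = 0 := by
      have := congrFun (congrArg (fun v => (star U).mulVec v) h3) i
      rw [Matrix.mulVec_mulVec, Matrix.mulVec_single_one, ← mul_assoc] at this
      simpa [Matrix.col_apply] using this
    simp [h4]

lemma trace_mul_nonneg {A B : Matrix d d ℂ} (hA : A.PosSemidef) (hB : B.PosSemidef) :
    0 ≤ (A * B).trace.re := by
  obtain ⟨w, hw, -, h, -⟩ := exists_spectral_weights hA hB.isHermitian
  have := h id
  rw [cfc_id ℝ B hB.isHermitian.isSelfAdjoint] at this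
  rw [this]
  exact Finset.sum_nonneg fun i _ => mul_nonneg (hw i) (hB.eigenvalues_nonneg i)

lemma trace_mul_mono {A B C : Matrix d d ℂ} (hA : A.PosSemidef) (h : B ≤ C) :
    (A * B).trace.re ≤ (A * C).trace.re := by
  have := trace_mul_nonneg hA (Matrix.le_iff.1 h)
  rw [mul_sub, Matrix.trace_sub, Complex.sub_re] at this
  linarith

lemma trace_mul_sum {ι : Type*} (t : Finset ι) (A : Matrix d d ℂ) (c : ι → ℝ)
    (B : ι → Matrix d d ℂ) :
    (A * ∑ i ∈ t, c i • B i).trace.re = ∑ i ∈ t, c i * (A * B i).trace.re := by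
  simp [Finset.mul_sum, Matrix.trace_sum, Complex.re_sum]

/-- `Tr[A M ^ a]` is nonnegative. -/
lemma trace_mul_rpow_nonneg {A M : Matrix d d ℂ} (hA : A.PosSemidef) (hM : M.PosSemidef) (a : ℝ) :
    0 ≤ (A * cfc (fun t : ℝ => t ^ a) M).trace.re := by
  obtain ⟨w, hw, -, h, -⟩ := exists_spectral_weights hA hM.isHermitian
  rw [h]
  exact Finset.sum_nonneg fun i _ =>
    mul_nonneg (hw i) (Real.rpow_nonneg (hM.eigenvalues_nonneg i) _)

/-- Jensen's inequality for the trace against a state. -/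
lemma trace_mul_rpow_le {A M : Matrix d d ℂ} (hA : IsState A) (hM : M.PosSemidef) {a : ℝ}
    (ha : 0 ≤ a) (ha1 : a ≤ 1) :
    (A * cfc (fun t : ℝ => t ^ a) M).trace.re ≤ (A * M).trace.re ^ a := by
  obtain ⟨w, hw, hw1, h, -⟩ := exists_spectral_weights hA.1 hM.isHermitian
  have h1 := h id
  rw [cfc_id ℝ M hM.isHermitian.isSelfAdjoint] at h1
  rw [h, h1]
  rw [hA.2, Complex.one_re] at hw1
  exact (Real.concaveOn_rpow ha ha1).le_map_sum (fun i _ => hw i) hw1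
    (fun i _ => hM.eigenvalues_nonneg i)

lemma trace_mul_log_le {A M : Matrix d d ℂ} (hA : IsState A) (hM : M.PosDef) :
    (A * cfc Real.log M).trace.re ≤ Real.log (A * M).trace.re := by
  obtain ⟨w, hw, hw1, h, -⟩ := exists_spectral_weights hA.1 hM.isHermitian
  have h1 := h id
  rw [cfc_id ℝ M hM.isHermitian.isSelfAdjoint] at h1
  rw [h, h1]
  rw [hA.2, Complex.one_re] at hw1
  exact strictConcaveOn_log_Ioi.concaveOn.le_map_sum (fun i _ => hw i) hw1
    (fun i _ => hM.eigenvalues_pos i)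

lemma trace_mul_pos {A M : Matrix d d ℂ} (hA : IsState A) (hM : M.PosDef) :
    0 < (A * M).trace.re := by
  obtain ⟨w, hw, hw1, h, -⟩ := exists_spectral_weights hA.1 hM.isHermitian
  have h1 := h id
  rw [cfc_id ℝ M hM.isHermitian.isSelfAdjoint] at h1
  rw [hA.2, Complex.one_re] at hw1
  rw [h1]
  obtain ⟨i, -, hi⟩ := Finset.exists_ne_zero_of_sum_ne_zero (hw1.trans_ne one_ne_zero)
  exact Finset.sum_pos' (fun j _ => mul_nonneg (hw j) (hM.eigenvalues_pos j).le)
    ⟨i, Finset.mem_univ i, mul_pos ((hw i).lt_of_ne' hi) (hM.eigenvalues_pos i)⟩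

lemma trace_mul_le_one {A M : Matrix d d ℂ} (hA : IsState A) (hM : (1 - M).PosSemidef) :
    (A * M).trace.re ≤ 1 := by
  have := trace_mul_nonneg hA.1 hM
  rw [mul_sub, mul_one, Matrix.trace_sub, hA.2, Complex.sub_re, Complex.one_re] at this
  linarith

lemma trace_mul_rpow_smul (A : Matrix d d ℂ) {M : Matrix d d ℂ} (hM : M.PosSemidef) {c : ℝ}
    (hc : 0 ≤ c) (a : ℝ) :
    (A * cfc (fun t : ℝ => t ^ a) (c • M)).trace.re =
      c ^ a * (A * cfc (fun t : ℝ => t ^ a) M).trace.re := by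
  have hfin := Matrix.finite_real_spectrum (A := M)
  have : cfc (fun t : ℝ => t ^ a) (c • M) = c ^ a • cfc (fun t : ℝ => t ^ a) M := by
    rw [← cfc_comp_const_mul c (fun t : ℝ => t ^ a) M ((hfin.image _).continuousOn _)
      hM.isHermitian.isSelfAdjoint, ← cfc_smul (c ^ a) _ M (hfin.continuousOn _)]
    refine cfc_congr fun t ht => ?_
    have ht0 : 0 ≤ t := by
      rw [hM.isHermitian.spectrum_real_eq_range_eigenvalues] at ht
      obtain ⟨i, rfl⟩ := ht
      exact hM.eigenvalues_nonneg i
    simp [Real.mul_rpow hc ht0]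
  rw [this]
  simp

lemma trace_mul_log_smul {A M : Matrix d d ℂ} (hA : IsState A) (hM : M.PosDef) {c : ℝ}
    (hc : 0 < c) :
    (A * cfc Real.log (c • M)).trace.re = Real.log c + (A * cfc Real.log M).trace.re := by
  have h := CFC.log_smul' (A := Matrix d d ℂ) M hc hM.isStrictlyPositive
  rw [CFC.log, CFC.log] at h
  rw [h, mul_add, Matrix.trace_add, Algebra.algebraMap_eq_smul_one]
  simp [hA.2]

/-- Superadditivity of the perspective of the operator concave function `t ^ a`. -/
lemma sum_perspective_rpow_le {ι : Type*} [Fintype ι] {A : Matrix d d ℂ} (hA : A.PosSemidef)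
    {a : ℝ} (ha : 0 < a) (ha1 : a ≤ 1) {r : ι → ℝ} (hr : ∀ i, 0 ≤ r i) {B : ι → Matrix d d ℂ}
    (hB : ∀ i, (B i).PosSemidef) :
    ∑ i, r i ^ (1 - a) * (A * cfc (fun t : ℝ => t ^ a) (B i)).trace.re ≤
      (∑ i, r i) ^ (1 - a) * (A * cfc (fun t : ℝ => t ^ a) (∑ i, B i)).trace.re := by
  classical
  have hsum : (∑ i, B i).PosSemidef := Matrix.posSemidef_sum _ fun i _ => hB i
  -- The case `a = 1` is separate because `0 ^ 0 = 1`: indices with `r i = 0` still contribute, but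
  -- everything is linear. For `a < 1` such indices drop out.
  rcases ha1.eq_or_lt with rfl | ha1
  · simp only [sub_self, Real.rpow_zero, Real.rpow_one, one_mul]
    rw [cfc_id' ℝ _ hsum.isHermitian.isSelfAdjoint]
    simp_rw [fun i => cfc_id' ℝ (B i) (hB i).isHermitian.isSelfAdjoint]
    simp [Finset.mul_sum, Matrix.trace_sum]
  set R := ∑ i, r i with hR
  have hR0 : 0 ≤ R := Finset.sum_nonneg fun i _ => hr i
  set t := Finset.univ.filter fun i => r i ≠ 0 with ht
  have htpos : ∀ i ∈ t, 0 < r i := fun i hi => (hr i).lt_of_ne' (Finset.mem_filter.1 hi).2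
  have hL : ∑ i, r i ^ (1 - a) * (A * cfc (fun t : ℝ => t ^ a) (B i)).trace.re =
      ∑ i ∈ t, r i ^ (1 - a) * (A * cfc (fun t : ℝ => t ^ a) (B i)).trace.re := by
    rw [ht, Finset.sum_filter]
    refine Finset.sum_congr rfl fun i _ => ?_
    split_ifs with h
    · rfl
    · rw [not_not.1 h, Real.zero_rpow (by linarith), zero_mul]
  rcases hR0.eq_or_lt with h0 | hRpos
  · have : t = ∅ := by
      rw [ht, Finset.filter_eq_empty_iff]
      intro i _
      simpa using (Finset.sum_eq_zero_iff_of_nonneg fun i _ => hr i).1 h0.symm i (Finset.mem_univ i)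
    rw [hL, this, Finset.sum_empty]
    exact mul_nonneg (Real.rpow_nonneg hR0 _) (trace_mul_rpow_nonneg hA hsum a)
  have hRt : ∑ i ∈ t, r i = R := by rw [ht, Finset.sum_filter_ne_zero]
  -- Jensen with weights `r i / R` at the points `(R / r i) • B i`, whose weighted mean is the sum
  -- of the `B i`.
  have hconc := (CFC.concaveOn_rpow (A := Matrix d d ℂ) (p := a) ⟨ha.le, ha1.le⟩).le_map_sum
    (t := t) (w := fun i => r i / R) (p := fun i => (R / r i) • B i)
    (fun i _ => div_nonneg (hr i) hR0) (by rw [← Finset.sum_div, hRt, div_self hRpos.ne'])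
    (fun i hi => Matrix.nonneg_iff_posSemidef.2
      (posSemidef_real_smul (hB i) (div_nonneg hR0 (hr i))))
  have heq : ∑ i ∈ t, (r i / R) • (R / r i) • B i = ∑ i ∈ t, B i := by
    refine Finset.sum_congr rfl fun i hi => ?_
    rw [smul_smul, div_mul_div_cancel₀ hRpos.ne', div_self (htpos i hi).ne', one_smul]
  rw [heq] at hconc
  -- Operator monotonicity of `t ^ a` puts back the `B i` with `r i = 0`.
  have hle : ∑ i ∈ t, B i ≤ ∑ i, B i :=
    Finset.sum_le_sum_of_subset_of_nonneg (Finset.subset_univ _)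
      fun i _ _ => Matrix.nonneg_iff_posSemidef.2 (hB i)
  have hmono := hconc.trans (CFC.rpow_le_rpow (p := a) ⟨ha.le, ha1.le⟩ hle)
  rw [CFC.rpow_eq_cfc_real (Matrix.nonneg_iff_posSemidef.2 hsum)] at hmono
  have htr := trace_mul_mono hA hmono
  rw [trace_mul_sum] at htr
  rw [hL]
  refine le_trans (le_of_eq ?_) (mul_le_mul_of_nonneg_left htr (Real.rpow_nonneg hR0 (1 - a)))
  rw [Finset.mul_sum]
  refine Finset.sum_congr rfl fun i hi => ?_
  rw [CFC.rpow_eq_cfc_real (Matrix.nonneg_iff_posSemidef.2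
      (posSemidef_real_smul (hB i) (div_nonneg hR0 (hr i)))),
    trace_mul_rpow_smul A (hB i) (div_nonneg hR0 (hr i)), ← mul_assoc, ← mul_assoc]
  congr 1
  have := htpos i hi
  rw [Real.div_rpow hR0 (hr i), Real.rpow_sub hRpos, Real.rpow_sub this, Real.rpow_one,
    Real.rpow_one]
  have h1 := (Real.rpow_pos_of_pos this a).ne'
  have h2 := (Real.rpow_pos_of_pos hRpos a).ne'
  field_simp

/-- Superadditivity of the perspective of the operator logarithm. -/
lemma sum_perspective_log_le {ι : Type*} [Fintype ι] {A : Matrix d d ℂ} (hA : IsState A)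
    {r : ι → ℝ} (hr : ∀ i, 0 ≤ r i) {B : ι → Matrix d d ℂ}
    (hB : ∀ i, (B i).PosSemidef) (hBr : ∀ i, r i ≠ 0 → (B i).PosDef) :
    ∑ i, r i * ((A * cfc Real.log (B i)).trace.re - Real.log (r i)) ≤
      (∑ i, r i) * ((A * cfc Real.log (∑ i, B i)).trace.re - Real.log (∑ i, r i)) := by
  classical
  set R := ∑ i, r i with hR
  have hR0 : 0 ≤ R := Finset.sum_nonneg fun i _ => hr i
  rcases hR0.eq_or_lt with h0 | hRpos
  · have h := (Finset.sum_eq_zero_iff_of_nonneg fun i _ => hr i).1 h0.symm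
    rw [← h0, zero_mul]
    exact (Finset.sum_eq_zero fun i hi => by rw [h i hi, zero_mul]).le
  set t := Finset.univ.filter fun i => r i ≠ 0 with ht
  have htne : ∀ i ∈ t, r i ≠ 0 := fun i hi => (Finset.mem_filter.1 hi).2
  have htpos : ∀ i ∈ t, 0 < r i := fun i hi => (hr i).lt_of_ne' (htne i hi)
  have hL : ∑ i, r i * ((A * cfc Real.log (B i)).trace.re - Real.log (r i)) =
      ∑ i ∈ t, r i * ((A * cfc Real.log (B i)).trace.re - Real.log (r i)) := by
    rw [ht, Finset.sum_filter]
    refine Finset.sum_congr rfl fun i _ => ?_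
    split_ifs with h
    · rfl
    · rw [not_not.1 h, zero_mul]
  have hRt : ∑ i ∈ t, r i = R := by rw [ht, Finset.sum_filter_ne_zero]
  have hconc := (CFC.concaveOn_log (A := Matrix d d ℂ)).le_map_sum
    (t := t) (w := fun i => r i / R) (p := fun i => (R / r i) • B i)
    (fun i _ => div_nonneg (hr i) hR0) (by rw [← Finset.sum_div, hRt, div_self hRpos.ne'])
    (fun i hi => (posDef_real_smul (hBr i (htne i hi))
      (div_pos hRpos (htpos i hi))).isStrictlyPositive)
  have heq : ∑ i ∈ t, (r i / R) • (R / r i) • B i = ∑ i ∈ t, B i := by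
    refine Finset.sum_congr rfl fun i hi => ?_
    rw [smul_smul, div_mul_div_cancel₀ hRpos.ne', div_self (htne i hi), one_smul]
  rw [heq] at hconc
  have hle : ∑ i ∈ t, B i ≤ ∑ i, B i :=
    Finset.sum_le_sum_of_subset_of_nonneg (Finset.subset_univ _)
      fun i _ _ => Matrix.nonneg_iff_posSemidef.2 (hB i)
  have htn : t.Nonempty := Finset.nonempty_of_sum_ne_zero (hRt.trans_ne hRpos.ne')
  -- Monotonicity of the operator logarithm needs the smaller side strictly positive, which is why
  -- `t` has to be nonempty.
  have hpd : (∑ i ∈ t, B i).PosDef := Matrix.posDef_sum htn fun i hi => hBr i (htne i hi)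
  have htr := trace_mul_mono hA.1 (hconc.trans (CFC.log_le_log hle hpd.isStrictlyPositive))
  rw [trace_mul_sum] at htr
  rw [hL]
  have hmul := mul_le_mul_of_nonneg_left htr hR0
  rw [mul_sub]
  refine le_trans (le_of_eq ?_) (sub_le_sub_right hmul _)
  rw [Finset.mul_sum, ← hRt, Finset.sum_mul, ← Finset.sum_sub_distrib, hRt]
  refine Finset.sum_congr rfl fun i hi => ?_
  have := trace_mul_log_smul hA (hBr i (htne i hi)) (div_pos hRpos (htpos i hi))
  rw [CFC.log, this, Real.log_div hRpos.ne' (htne i hi)]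
  field_simp
  ring

end Spectral

/-! ### Functional calculus of block diagonal matrices. -/

section Block
variable {X d : Type*} [Fintype X] [DecidableEq X] [Fintype d] [DecidableEq d]

/-- The embedding of families of blocks as block diagonal matrices. -/
def blockDiagonalAlgHom (X d : Type*) [Fintype X] [DecidableEq X] [Fintype d] [DecidableEq d] :
    (X → Matrix d d ℂ) →ₐ[ℝ] Matrix (d × X) (d × X) ℂ where
  toRingHom := Matrix.blockDiagonalRingHom d X ℂ
  commutes' r := by
    simp only [Algebra.algebraMap_eq_smul_one]
    exact (Matrix.blockDiagonal_smul r (1 : X → Matrix d d ℂ)).trans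
      (by rw [Matrix.blockDiagonal_one])

omit [Fintype X] [Fintype d] [DecidableEq d] in
lemma isHermitian_blockDiagonal {M : X → Matrix d d ℂ} (hM : ∀ x, (M x).IsHermitian) :
    (Matrix.blockDiagonal M).IsHermitian := by
  rw [Matrix.IsHermitian, Matrix.blockDiagonal_conjTranspose]
  exact congrArg _ (funext hM)

/-- All the spectra involved are finite, so one Lagrange polynomial agrees with `f` on them, and
polynomials commute with algebra homomorphisms. -/
lemma cfc_blockDiagonal (f : ℝ → ℝ) {M : X → Matrix d d ℂ} (hM : ∀ x, (M x).IsHermitian) :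
    cfc f (Matrix.blockDiagonal M) = Matrix.blockDiagonal fun x => cfc f (M x) := by
  have hfin : (spectrum ℝ (Matrix.blockDiagonal M) ∪ ⋃ x, spectrum ℝ (M x)).Finite :=
    Matrix.finite_real_spectrum.union (Set.finite_iUnion fun x => Matrix.finite_real_spectrum)
  set q : Polynomial ℝ := Lagrange.interpolate hfin.toFinset id f
  have hq : ∀ t ∈ spectrum ℝ (Matrix.blockDiagonal M) ∪ ⋃ x, spectrum ℝ (M x), f t = q.eval t :=
    fun t ht => (Lagrange.eval_interpolate_at_node f (Set.injOn_id _)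
      (hfin.mem_toFinset.2 ht)).symm
  rw [cfc_congr fun t ht => hq t (Or.inl ht),
    cfc_polynomial q _ (isHermitian_blockDiagonal hM).isSelfAdjoint]
  have h1 : ∀ x, cfc f (M x) = Polynomial.aeval M q x := fun x => by
    rw [cfc_congr fun t ht => hq t (Or.inr (Set.mem_iUnion_of_mem x ht)),
      cfc_polynomial q _ (hM x).isSelfAdjoint]
    exact Polynomial.aeval_algHom_apply (Pi.evalAlgHom ℝ (fun _ : X => Matrix d d ℂ) x) M q
  rw [funext h1]
  exact Polynomial.aeval_algHom_apply (blockDiagonalAlgHom X d) M q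

lemma trace_blockDiagonal_mul_cfc (f : ℝ → ℝ) (τ : X → Matrix d d ℂ) {M : X → Matrix d d ℂ}
    (hM : ∀ x, (M x).IsHermitian) :
    (Matrix.blockDiagonal τ * cfc f (Matrix.blockDiagonal M)).trace.re =
      ∑ x, (τ x * cfc f (M x)).trace.re := by
  rw [cfc_blockDiagonal f hM, ← Matrix.blockDiagonal_mul, Matrix.trace_blockDiagonal,
    Complex.re_sum]

lemma posSemidef_blockDiagonal {M : X → Matrix d d ℂ} (hM : ∀ x, (M x).PosSemidef) :
    (Matrix.blockDiagonal M).PosSemidef := by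
  choose B hB using fun x => CStarAlgebra.nonneg_iff_eq_star_mul_self.1 (hM x).nonneg
  have : M = fun x => (B x).conjTranspose * B x := funext hB
  rw [this, Matrix.blockDiagonal_mul, ← Matrix.blockDiagonal_conjTranspose]
  exact Matrix.posSemidef_conjTranspose_mul_self _

end Block

/-! ### POVMs and the expected gain, block by block. -/

section POVM

variable {X d : Type*} [Fintype X] [DecidableEq X] [Fintype d] [DecidableEq d]

lemma IsPOVM.one_sub {M : X → Matrix d d ℂ} (hM : IsPOVM M) (x : X) : (1 - M x).PosSemidef := by
  rw [← hM.2, ← Finset.add_sum_erase _ _ (Finset.mem_univ x), add_sub_cancel_left]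
  exact Matrix.posSemidef_sum _ fun y _ => hM.1 y

lemma expectedGain_eq (a : ℝ) (τ : X → Matrix d d ℂ) {M : X → Matrix d d ℂ} (hM : IsPOVM M) :
    expectedGain a τ M = ∑ x, (τ x * cfc (fun t : ℝ => t ^ a) (M x)).trace.re :=
  trace_blockDiagonal_mul_cfc _ τ fun x => (hM.1 x).isHermitian

omit [DecidableEq X] in
lemma isPOVM_smul_one {q : X → ℝ} (hq : q ∈ stdSimplex ℝ X) :
    IsPOVM fun x => q x • (1 : Matrix d d ℂ) :=
  ⟨fun x => posSemidef_real_smul Matrix.PosSemidef.one (hq.1 x), by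
    rw [← Finset.sum_smul, hq.2, one_smul]⟩

end POVM

/-! ### The gain without observation. -/

section Prior

variable {S : Type*} [Fintype S]

lemma stdSimplex_le_one {q : S → ℝ} (hq : q ∈ stdSimplex ℝ S) (s : S) : q s ≤ 1 :=
  hq.2 ▸ Finset.single_le_sum (fun i _ => hq.1 i) (Finset.mem_univ s)

lemma exists_ne_zero_of_mem_stdSimplex {q : S → ℝ} (hq : q ∈ stdSimplex ℝ S) : ∃ s, q s ≠ 0 := by
  obtain ⟨s, -, hs⟩ := Finset.exists_ne_zero_of_sum_ne_zero (hq.2.trans_ne one_ne_zero)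
  exact ⟨s, hs⟩

lemma sum_mul_rpow_le_priorGain {v q : S → ℝ} (hv : ∀ s, 0 ≤ v s) (hq : q ∈ stdSimplex ℝ S)
    {a : ℝ} (ha : 0 ≤ a) : ∑ s, v s * q s ^ a ≤ priorGain a v := by
  refine le_ciSup (f := fun q : stdSimplex ℝ S => ∑ x, v x * (q : S → ℝ) x ^ a)
    ⟨∑ s, v s, ?_⟩ ⟨q, hq⟩
  rintro _ ⟨q, rfl⟩
  refine Finset.sum_le_sum fun s _ => mul_le_of_le_one_right (hv s) ?_
  exact Real.rpow_le_one (q.2.1 s) (stdSimplex_le_one q.2 s) ha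

/-- The optimal guess for the weights `v` dominates them: Hölder's inequality is tight. -/
lemma exists_tilt {v : S → ℝ} (hv : v ∈ stdSimplex ℝ S) {a : ℝ} (ha : 0 < a) (ha1 : a ≤ 1) :
    ∃ r ∈ stdSimplex ℝ S, ∀ s, v s ≤ priorGain a v * r s ^ (1 - a) := by
  classical
  rcases ha1.eq_or_lt with rfl | ha1
  -- For `a = 1` the factor `r s ^ 0` is `1` whatever `r` is; point masses show that the prior gain
  -- dominates every `v s`.
  · refine ⟨v, hv, fun s => ?_⟩
    have := sum_mul_rpow_le_priorGain hv.1 (single_mem_stdSimplex ℝ s) zero_le_one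
    simpa [Pi.single_apply] using this
  have h1a : 0 < 1 - a := by linarith
  -- The Hölder optimiser is `r ∝ v ^ (1 / (1 - a))`; its gain is `N ^ (1 - a)`, exactly the ratio
  -- of `v` to `r ^ (1 - a)`.
  set N := ∑ s, v s ^ (1 - a)⁻¹ with hN
  obtain ⟨s₀, hs₀⟩ := exists_ne_zero_of_mem_stdSimplex hv
  have hpos : ∀ s, 0 ≤ v s ^ (1 - a)⁻¹ := fun s => Real.rpow_nonneg (hv.1 s) _
  have hN0 : 0 < N := Finset.sum_pos' (fun s _ => hpos s)
    ⟨s₀, Finset.mem_univ _, Real.rpow_pos_of_pos ((hv.1 s₀).lt_of_ne' hs₀) _⟩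
  set r : S → ℝ := fun s => v s ^ (1 - a)⁻¹ / N with hr
  have hrm : r ∈ stdSimplex ℝ S :=
    ⟨fun s => div_nonneg (hpos s) hN0.le, by rw [hr, ← Finset.sum_div, ← hN, div_self hN0.ne']⟩
  have hv' : ∀ s, v s = N ^ (1 - a) * r s ^ (1 - a) := fun s => by
    rw [← Real.mul_rpow hN0.le (hrm.1 s), hr]
    simp only
    rw [mul_div_cancel₀ _ hN0.ne', Real.rpow_inv_rpow (hv.1 s) h1a.ne']
  refine ⟨r, hrm, fun s => ?_⟩
  have hle := sum_mul_rpow_le_priorGain hv.1 hrm ha.le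
  have hsum : ∑ s, v s * r s ^ a = N ^ (1 - a) := by
    calc ∑ s, v s * r s ^ a = ∑ s, N ^ (1 - a) * r s := by
          refine Finset.sum_congr rfl fun s _ => ?_
          rw [hv' s, mul_assoc, ← Real.rpow_add' (hrm.1 s) (by simp)]
          simp
      _ = N ^ (1 - a) := by rw [← Finset.mul_sum, hrm.2, mul_one]
  rw [hsum] at hle
  conv_lhs => rw [hv' s]
  exact mul_le_mul_of_nonneg_right hle (Real.rpow_nonneg (hrm.1 s) _)

/-- Hölder's inequality, from the weighted arithmetic-geometric mean inequality in each term. It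
bounds the prior gain of weights dominated by `r ^ (1 - a)`, a converse to `exists_tilt`. -/
lemma sum_rpow_mul_rpow_le_one {r q : S → ℝ} (hr : r ∈ stdSimplex ℝ S) (hq : q ∈ stdSimplex ℝ S)
    {a : ℝ} (ha : 0 ≤ a) (ha1 : a ≤ 1) : ∑ s, r s ^ (1 - a) * q s ^ a ≤ 1 := by
  calc ∑ s, r s ^ (1 - a) * q s ^ a ≤ ∑ s, ((1 - a) * r s + a * q s) :=
        Finset.sum_le_sum fun s _ => Real.geom_mean_le_arith_mean2_weighted (by linarith) ha
          (hr.1 s) (hq.1 s) (by ring)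
    _ = 1 := by rw [Finset.sum_add_distrib, ← Finset.mul_sum, ← Finset.mul_sum, hr.2, hq.2]; ring

lemma priorGain_pos {v : S → ℝ} (hv : v ∈ stdSimplex ℝ S) {a : ℝ} (ha : 0 < a) (ha1 : a ≤ 1) :
    0 < priorGain a v := by
  obtain ⟨r, hr, h⟩ := exists_tilt hv ha ha1
  obtain ⟨s, hs⟩ := exists_ne_zero_of_mem_stdSimplex hv
  by_contra! hle
  exact hs (le_antisymm ((h s).trans (mul_nonpos_of_nonpos_of_nonneg hle
    (Real.rpow_nonneg (hr.1 s) _))) (hv.1 s))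

end Prior

/-! ### The gain capacity and the upper bound on the maximal leakage. -/

section Capacity

variable {X d : Type*} [Fintype X] [Fintype d] [DecidableEq d]

/-- Pairs of a distribution and a POVM on `X` that vanish where `p` does. -/
structure IsStrategy (p r : X → ℝ) (M : X → Matrix d d ℂ) : Prop where
  mem : r ∈ stdSimplex ℝ X
  povm : IsPOVM M
  supp : ∀ x, p x = 0 → r x = 0 ∧ M x = 0

/-- The expected gain for the tilted weights `r x ^ (1 - a)`. -/
noncomputable def tiltedGain (a : ℝ) (ρ : X → Matrix d d ℂ) (r : X → ℝ) (M : X → Matrix d d ℂ) :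
    ℝ :=
  ∑ x, r x ^ (1 - a) * (ρ x * cfc (fun t : ℝ => t ^ a) (M x)).trace.re

/-- The values of `tiltedGain` over all strategies. -/
def tiltedGains (a : ℝ) (p : X → ℝ) (ρ : X → Matrix d d ℂ) : Set ℝ :=
  {g | ∃ r M, IsStrategy p r M ∧ tiltedGain a ρ r M = g}

/-- The supremum of the tilted gains, an exponentiated measured Rényi capacity. -/
noncomputable def gainCapacity (a : ℝ) (p : X → ℝ) (ρ : X → Matrix d d ℂ) : ℝ :=
  sSup (tiltedGains a p ρ)

variable {p : X → ℝ} {ρ : X → Matrix d d ℂ} {a : ℝ}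

/-- By Jensen and `M x ≤ 1` every summand is at most `1`, and off the support of `p` the matrix `M
x` vanishes. -/
lemma IsStrategy.tiltedGain_le {r : X → ℝ} {M : X → Matrix d d ℂ}
    (h : IsStrategy p r M) (hρ : ∀ x, IsState (ρ x)) (ha : 0 < a) (ha1 : a ≤ 1) :
    tiltedGain a ρ r M ≤ ((Function.support p).ncard : ℝ) := by
  classical
  have hterm : ∀ x, r x ^ (1 - a) * (ρ x * cfc (fun t : ℝ => t ^ a) (M x)).trace.re ≤
      if p x ≠ 0 then 1 else 0 := by
    intro x
    have h0 := trace_mul_nonneg (hρ x).1 (h.povm.1 x)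
    split_ifs with hx
    · refine mul_le_one₀ (Real.rpow_le_one (h.mem.1 x) (stdSimplex_le_one h.mem x) (by linarith))
        (trace_mul_rpow_nonneg (hρ x).1 (h.povm.1 x) a) ?_
      exact (trace_mul_rpow_le (hρ x) (h.povm.1 x) ha.le ha1).trans
        (Real.rpow_le_one h0 (trace_mul_le_one (hρ x) (h.povm.one_sub x)) ha.le)
    · have := trace_mul_rpow_le (hρ x) (h.povm.1 x) ha.le ha1
      rw [(h.supp x (not_not.1 hx)).2] at this ⊢
      rw [mul_zero, Matrix.trace_zero, Complex.zero_re, Real.zero_rpow ha.ne'] at this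
      exact mul_nonpos_of_nonneg_of_nonpos (Real.rpow_nonneg (h.mem.1 x) _) this
  refine (Finset.sum_le_sum fun x _ => hterm x).trans (le_of_eq ?_)
  rw [Finset.sum_boole, Set.ncard_eq_toFinset_card']
  congr 2
  ext x
  simp

lemma bddAbove_tiltedGains (hρ : ∀ x, IsState (ρ x)) (ha : 0 < a) (ha1 : a ≤ 1) :
    BddAbove (tiltedGains a p ρ) := by
  refine ⟨(Function.support p).ncard, ?_⟩
  rintro _ ⟨r, M, h, rfl⟩
  exact h.tiltedGain_le hρ ha ha1

lemma IsStrategy.le_gainCapacity {r : X → ℝ} {M : X → Matrix d d ℂ}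
    (h : IsStrategy p r M) (hρ : ∀ x, IsState (ρ x)) (ha : 0 < a) (ha1 : a ≤ 1) :
    tiltedGain a ρ r M ≤ gainCapacity a p ρ :=
  le_csSup (bddAbove_tiltedGains hρ ha ha1) ⟨r, M, h, rfl⟩

lemma IsStrategy.smul_one (hp : p ∈ stdSimplex ℝ X) :
    IsStrategy p p fun x => p x • (1 : Matrix d d ℂ) := by
  classical
  exact ⟨hp, isPOVM_smul_one hp, fun x hx => ⟨hx, by simp [hx]⟩⟩

lemma tiltedGains_nonempty (hp : p ∈ stdSimplex ℝ X) : (tiltedGains a p ρ).Nonempty :=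
  ⟨_, _, _, .smul_one hp, rfl⟩

/-- The uninformative strategy `r = p`, `M x = p x • 1` has value `∑ p ^ (1 - a) * p ^ a = 1`. -/
lemma one_le_gainCapacity (hp : p ∈ stdSimplex ℝ X) (hρ : ∀ x, IsState (ρ x)) (ha : 0 < a)
    (ha1 : a ≤ 1) : 1 ≤ gainCapacity a p ρ := by
  refine le_trans (le_of_eq ?_) ((IsStrategy.smul_one hp).le_gainCapacity hρ ha ha1)
  rw [tiltedGain]
  refine hp.2.symm.trans ?_
  refine Finset.sum_congr rfl fun x _ => ?_
  rw [trace_mul_rpow_smul (ρ x) Matrix.PosSemidef.one (hp.1 x), cfc_apply_one]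
  simp only [Real.one_rpow, map_one, mul_one, (hρ x).2, Complex.one_re]
  rw [← Real.rpow_add' (hp.1 x) (by simp)]
  simp

/-- The posterior distribution of `X` given `S = s`, with an arbitrary choice on null events. -/
noncomputable def posterior {S : Type*} (p : X → ℝ) (W : X → S → ℝ) (s : S) (x : X) : ℝ :=
  if ∑ y, p y * W y s = 0 then p x else p x * W x s / ∑ y, p y * W y s

section posterior

variable {S : Type*} [Fintype S] {W : X → S → ℝ}

lemma posterior_mem (hp : p ∈ stdSimplex ℝ X) (hW : ∀ x, W x ∈ stdSimplex ℝ S) (s : S) :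
    posterior p W s ∈ stdSimplex ℝ X := by
  by_cases h : ∑ y, p y * W y s = 0
  · have : posterior p W s = p := funext fun x => if_pos h
    rwa [this]
  · have : posterior p W s = fun x => p x * W x s / ∑ y, p y * W y s := funext fun x => if_neg h
    rw [this]
    refine ⟨fun x => ?_, ?_⟩
    · exact div_nonneg (mul_nonneg (hp.1 x) ((hW x).1 s))
        (Finset.sum_nonneg fun y _ => mul_nonneg (hp.1 y) ((hW y).1 s))
    · rw [← Finset.sum_div, div_self h]

lemma mul_posterior (hp : p ∈ stdSimplex ℝ X) (hW : ∀ x, W x ∈ stdSimplex ℝ S) (s : S) (x : X) :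
    (∑ y, p y * W y s) * posterior p W s x = p x * W x s := by
  rw [posterior]
  split_ifs with h
  · rw [h, zero_mul]
    exact ((Finset.sum_eq_zero_iff_of_nonneg
      fun y _ => mul_nonneg (hp.1 y) ((hW y).1 s)).1 h x (Finset.mem_univ x)).symm
  · exact mul_div_cancel₀ _ h

omit [Fintype S] in
lemma posterior_eq_zero {x : X} (hx : p x = 0) (s : S) : posterior p W s x = 0 := by
  simp [posterior, hx]

lemma pushforward_mem (hp : p ∈ stdSimplex ℝ X) (hW : ∀ x, W x ∈ stdSimplex ℝ S) :
    (fun s => ∑ x, p x * W x s) ∈ stdSimplex ℝ S := by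
  refine ⟨fun s => Finset.sum_nonneg fun x _ => mul_nonneg (hp.1 x) ((hW x).1 s), ?_⟩
  rw [Finset.sum_comm]
  simp_rw [← Finset.mul_sum, fun x => (hW x).2, mul_one]
  exact hp.2

lemma IsPOVM.posterior_sum {M : S → Matrix d d ℂ} (hM : IsPOVM M)
    {P : S → X → ℝ} (hP : ∀ s, P s ∈ stdSimplex ℝ X) :
    IsPOVM fun x => ∑ s, P s x • M s := by
  refine ⟨fun x => Matrix.posSemidef_sum _ fun s _ => posSemidef_real_smul (hM.1 s) ((hP s).1 x),
    ?_⟩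
  rw [Finset.sum_comm]
  simp_rw [← Finset.sum_smul, fun s => (hP s).2, one_smul]
  exact hM.2

omit [Fintype S] [DecidableEq d] in
lemma trace_relabel_mul (W : X → S → ℝ) (p : X → ℝ) (ρ : X → Matrix d d ℂ) (s : S)
    (B : Matrix d d ℂ) :
    (relabel W (cqBlocks p ρ) s * B).trace.re = ∑ x, p x * W x s * (ρ x * B).trace.re := by
  simp [relabel, cqBlocks, Finset.sum_mul, Matrix.trace_sum, mul_assoc, mul_left_comm]

omit [Fintype S] in
lemma classicalMarginal_relabel (hρ : ∀ x, IsState (ρ x)) (W : X → S → ℝ) :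
    classicalMarginal (relabel W (cqBlocks p ρ)) = fun s => ∑ x, p x * W x s := by
  funext s
  have := trace_relabel_mul W p ρ s 1
  simpa [classicalMarginal, (hρ _).2] using this

/-- Guessing a function of `X` is, relative to the prior, no better than the capacity. -/
lemma sum_gain_le (hp : p ∈ stdSimplex ℝ X) (hρ : ∀ x, IsState (ρ x)) (ha : 0 < a) (ha1 : a ≤ 1)
    (hW : ∀ x, W x ∈ stdSimplex ℝ S) {M : S → Matrix d d ℂ} (hM : IsPOVM M) :
    ∑ s, (relabel W (cqBlocks p ρ) s * cfc (fun t : ℝ => t ^ a) (M s)).trace.re ≤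
      priorGain a (fun s => ∑ x, p x * W x s) * gainCapacity a p ρ := by
  set v : S → ℝ := fun s => ∑ x, p x * W x s with hv
  have hvm : v ∈ stdSimplex ℝ S := pushforward_mem hp hW
  obtain ⟨r, hr, hvr⟩ := exists_tilt hvm ha ha1
  have hP0 := (priorGain_pos hvm ha ha1).le
  set P := posterior p W with hP
  have hPm : ∀ s, P s ∈ stdSimplex ℝ X := posterior_mem hp hW
  -- The strategy on `X`: both the tilt `r` and the POVM are pushed forward along the posterior `s ↦
  -- P s`.
  have hstr : IsStrategy p (fun x => ∑ s, r s * P s x) (fun x => ∑ s, P s x • M s) :=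
    ⟨pushforward_mem hr hPm, hM.posterior_sum hPm,
      fun x hx => ⟨by simp [hP, posterior_eq_zero hx], by simp [hP, posterior_eq_zero hx]⟩⟩
  refine le_trans ?_ (mul_le_mul_of_nonneg_left (hstr.le_gainCapacity hρ ha ha1) hP0)
  simp_rw [trace_relabel_mul]
  rw [Finset.sum_comm, tiltedGain, Finset.mul_sum]
  refine Finset.sum_le_sum fun x _ => ?_
  -- For fixed `x`, superadditivity over `s` applied to the pairs `(r s * P s x, P s x • M s)`; the
  -- powers of `P s x` recombine to `P s x` itself.
  refine le_trans ?_ (mul_le_mul_of_nonneg_left (sum_perspective_rpow_le (hρ x).1 ha ha1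
    (r := fun s => r s * P s x) (fun s => mul_nonneg (hr.1 s) ((hPm s).1 x))
    (fun s => posSemidef_real_smul (hM.1 s) ((hPm s).1 x))) hP0)
  rw [Finset.mul_sum]
  refine Finset.sum_le_sum fun s _ => ?_
  have hPx := (hPm s).1 x
  have hpow : P s x ^ (1 - a) * P s x ^ a = P s x := by
    rw [← Real.rpow_add' hPx (by simp), sub_add_cancel, Real.rpow_one]
  rw [trace_mul_rpow_smul (ρ x) (hM.1 s) hPx, Real.mul_rpow (hr.1 s) hPx, mul_assoc (r s ^ (1 - a)),
    ← mul_assoc (P s x ^ (1 - a)), hpow, ← mul_assoc, ← mul_assoc]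
  refine mul_le_mul_of_nonneg_right ?_ (trace_mul_rpow_nonneg (hρ x).1 (hM.1 s) a)
  rw [← mul_posterior hp hW]
  exact mul_le_mul_of_nonneg_right (hvr s) hPx

end posterior

end Capacity

/-! ### Splitting one atom into parts. -/

section Split

open Filter

/-- Splitting an atom into `m` parts: the guessing value `N` of the parts can be prescribed. -/
lemma eventually_exists_split {a N : ℝ} (ha : 0 < a) (ha1 : a ≤ 1) (hN : 0 < N) (hN1 : N ≤ 1) :
    ∀ᶠ m : ℕ in atTop, ∃ u ∈ stdSimplex ℝ (Fin m), ∃ z ∈ stdSimplex ℝ (Fin m),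
      (∀ i, u i ≤ N * z i ^ (1 - a)) ∧ N ≤ ∑ i, u i * z i ^ a := by
  rcases ha1.eq_or_lt with rfl | ha1
  -- For `a = 1` only the largest part counts: one part gets mass `N`, the other `k ≥ 1 / N` share
  -- the rest and stay below `N`, and `z` is the point mass at the large part.
  · have h1 : ∀ᶠ m : ℕ in atTop, N⁻¹ + 1 ≤ (m : ℝ) :=
      tendsto_natCast_atTop_atTop.eventually_ge_atTop _
    filter_upwards [h1] with m hm
    have hinv : 1 ≤ N⁻¹ := (one_le_inv₀ hN).2 hN1
    obtain ⟨k, rfl⟩ : ∃ k, m = k + 1 := Nat.exists_eq_succ_of_ne_zero (by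
      rintro rfl
      simp only [Nat.cast_zero] at hm
      linarith)
    push_cast at hm
    have hk : N⁻¹ ≤ (k : ℝ) := by linarith
    have hk0 : (0 : ℝ) < k := by linarith
    have hkN : 1 ≤ N * k := by
      have := mul_le_mul_of_nonneg_left hk hN.le
      rwa [mul_inv_cancel₀ hN.ne'] at this
    have hrest : (1 - N) / k ≤ N := by
      rw [div_le_iff₀ hk0]
      linarith
    refine ⟨Fin.cons N fun _ => (1 - N) / k, ⟨fun i => ?_, ?_⟩, Pi.single 0 1,
      single_mem_stdSimplex ℝ 0, fun i => ?_, ?_⟩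
    · refine Fin.cases ?_ (fun j => ?_) i
      · simpa using hN.le
      · simpa using div_nonneg (sub_nonneg.2 hN1) hk0.le
    · rw [Fin.sum_univ_succ]
      simp only [Fin.cons_zero, Fin.cons_succ, Finset.sum_const, Finset.card_univ,
        Fintype.card_fin, nsmul_eq_mul]
      field_simp
      ring
    · refine Fin.cases ?_ (fun j => ?_) i
      · simp
      · simpa using hrest
    · rw [Fin.sum_univ_succ]
      simp
  · have h1a : 0 < 1 - a := by linarith
    have h1 : ∀ᶠ m : ℕ in atTop, N⁻¹ ≤ (m : ℝ) ^ a :=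
      ((tendsto_rpow_atTop ha).comp tendsto_natCast_atTop_atTop).eventually_ge_atTop _
    filter_upwards [h1, eventually_gt_atTop 0] with m hm hm0
    have : NeZero m := ⟨hm0.ne'⟩
    have hmpos : (0 : ℝ) < m := Nat.cast_pos.2 hm0
    have hcont : ContinuousOn (fun z : Fin m → ℝ => ∑ i, z i ^ (1 - a))
        (stdSimplex ℝ (Fin m)) := by
      refine Continuous.continuousOn (continuous_finsetSum _ fun i _ => ?_)
      exact (continuous_apply i).rpow_const fun _ => Or.inr h1a.le
    have hunif : (fun _ : Fin m => (m : ℝ)⁻¹) ∈ stdSimplex ℝ (Fin m) :=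
      ⟨fun _ => by positivity, by simp [hmpos.ne']⟩
    -- The sum of `z i ^ (1 - a)` runs from `1` at a point mass to `m ^ a` at the uniform
    -- distribution, so it takes the value `1 / N`; then `u = N * z ^ (1 - a)` has total mass `1`.
    obtain ⟨z, hz, hzN⟩ := (convex_stdSimplex ℝ (Fin m)).isPreconnected.intermediate_value
      (single_mem_stdSimplex ℝ 0) hunif hcont (show N⁻¹ ∈ Set.Icc _ _ by
        constructor
        · refine le_trans (le_of_eq ?_) ((one_le_inv₀ hN).2 hN1)
          rw [Finset.sum_eq_single 0]
          · simp
          · intro i _ hi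
            simp [Pi.single_eq_of_ne hi, Real.zero_rpow h1a.ne']
          · simp
        · refine hm.trans (le_of_eq ?_)
          simp only [Finset.sum_const, Finset.card_univ, Fintype.card_fin, nsmul_eq_mul]
          rw [Real.inv_rpow hmpos.le, Real.rpow_sub hmpos, Real.rpow_one]
          have := (Real.rpow_pos_of_pos hmpos a).ne'
          field_simp)
    simp only at hzN
    refine ⟨fun i => N * z i ^ (1 - a),
      ⟨fun i => mul_nonneg hN.le (Real.rpow_nonneg (hz.1 i) _), ?_⟩, z, hz, fun i => le_rfl, ?_⟩
    · rw [← Finset.mul_sum, hzN, mul_inv_cancel₀ hN.ne']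
    · refine le_of_eq ?_
      calc N = ∑ i, N * z i := by rw [← Finset.mul_sum, hz.2, mul_one]
        _ = _ := by
          refine Finset.sum_congr rfl fun i _ => ?_
          rw [mul_assoc, ← Real.rpow_add' (hz.1 i) (by simp), sub_add_cancel, Real.rpow_one]

end Split

/-! ### Realising a strategy by a refinement of `X`. -/

section Lower

variable {X d : Type*} [Fintype X] [Fintype d] [DecidableEq d] {p : X → ℝ}
  {ρ : X → Matrix d d ℂ} {a : ℝ}

/-- A strategy whose distribution is positive on the support of `p` is realised by guessing a
refinement of `X`. -/
lemma IsStrategy.exists_refinement [DecidableEq X] {r : X → ℝ} {M : X → Matrix d d ℂ}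
    (h : IsStrategy p r M) (hp : p ∈ stdSimplex ℝ X) (hρ : ∀ x, IsState (ρ x)) (ha : 0 < a)
    (ha1 : a ≤ 1) (hr : ∀ x, p x ≠ 0 → r x ≠ 0) :
    ∃ (m : ℕ) (W : X → X × Fin m → ℝ) (K : X × Fin m → Matrix d d ℂ) (c : ℝ),
      (∀ x, W x ∈ stdSimplex ℝ (X × Fin m)) ∧ IsPOVM K ∧ 0 < c ∧
      (∀ q ∈ stdSimplex ℝ (X × Fin m), ∑ s, (∑ x, p x * W x s) * q s ^ a ≤ c) ∧
      c * tiltedGain a ρ r M ≤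
        ∑ s, (relabel W (cqBlocks p ρ) s * cfc (fun t : ℝ => t ^ a) (K s)).trace.re := by
  obtain ⟨x₀, hx₀⟩ := exists_ne_zero_of_mem_stdSimplex hp
  set t := Finset.univ.filter fun x => p x ≠ 0 with ht
  -- The constant `c` is the least nonzero value of `p`, so that every splitting value `N x = c * r
  -- x ^ (1 - a) / p x` is at most `1`.
  obtain ⟨x₁, hx₁, hmin⟩ := t.exists_min_image p ⟨x₀, by simp [ht, hx₀]⟩
  have hx₁' : p x₁ ≠ 0 := (Finset.mem_filter.1 hx₁).2
  set c := p x₁ with hc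
  have hc0 : 0 < c := (hp.1 x₁).lt_of_ne' hx₁'
  have hcp : ∀ x, p x ≠ 0 → c ≤ p x := fun x hx => hmin x (by simp [ht, hx])
  have hpp : ∀ x, p x ≠ 0 → 0 < p x := fun x hx => (hp.1 x).lt_of_ne' hx
  set N : X → ℝ := fun x => c * r x ^ (1 - a) / p x with hN
  have hr1 : ∀ x, r x ^ (1 - a) ≤ 1 := fun x =>
    Real.rpow_le_one (h.mem.1 x) (stdSimplex_le_one h.mem x) (by linarith)
  have hsplit : ∀ᶠ m : ℕ in Filter.atTop, ∀ x, ∃ u ∈ stdSimplex ℝ (Fin m),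
      ∃ z ∈ stdSimplex ℝ (Fin m), p x ≠ 0 →
        (∀ i, u i ≤ N x * z i ^ (1 - a)) ∧ N x ≤ ∑ i, u i * z i ^ a := by
    -- Since `X` is finite, one number of parts `m` serves all `x`; off the support of `p` the
    -- choice is arbitrary.
    refine Filter.eventually_all.2 fun x => ?_
    by_cases hx : p x = 0
    · filter_upwards [eventually_exists_split ha ha1 one_pos le_rfl] with m ⟨u, hu, z, hz, _⟩
      exact ⟨u, hu, z, hz, fun h' => absurd hx h'⟩
    · have hrx : 0 < r x ^ (1 - a) :=
        Real.rpow_pos_of_pos ((h.mem.1 x).lt_of_ne' (hr x hx)) _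
      have hNx : 0 < N x := div_pos (mul_pos hc0 hrx) (hpp x hx)
      have hNx1 : N x ≤ 1 := by
        rw [hN, div_le_one (hpp x hx)]
        exact (mul_le_of_le_one_right hc0.le (hr1 x)).trans (hcp x hx)
      filter_upwards [eventually_exists_split ha ha1 hNx hNx1] with m ⟨u, hu, z, hz, huz⟩
      exact ⟨u, hu, z, hz, fun _ => huz⟩
  obtain ⟨m, hm⟩ := hsplit.exists
  choose u hu z hz huz using hm
  have hNp : ∀ x, p x ≠ 0 → p x * N x = c * r x ^ (1 - a) := fun x hx =>
    mul_div_cancel₀ _ hx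
  set W : X → X × Fin m → ℝ := fun x s => if s.1 = x then u x s.2 else 0 with hW
  have hpush : ∀ (f : X → ℝ) (s : X × Fin m),
      ∑ x, p x * W x s * f x = p s.1 * u s.1 s.2 * f s.1 := by
    intro f s
    rw [Finset.sum_eq_single s.1]
    · simp [hW]
    · intro y _ hy
      simp [hW, hy.symm]
    · simp
  -- The channel splits `x` into parts `(x, i)` with probabilities `u x i`; the POVM first measures
  -- `M`, then guesses the part according to `z x`.
  refine ⟨m, W, fun s => z s.1 s.2 • M s.1, c, fun x => ⟨fun s => ?_, ?_⟩, ⟨fun s => ?_, ?_⟩, hc0,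
    fun q hq => ?_, ?_⟩
  · simp only [hW]
    split_ifs
    exacts [(hu x).1 _, le_rfl]
  · rw [Fintype.sum_prod_type, Finset.sum_eq_single x]
    · simpa [hW] using (hu x).2
    · intro y _ hy
      simp [hW, hy]
    · simp
  · exact posSemidef_real_smul (h.povm.1 _) ((hz _).1 _)
  · rw [Fintype.sum_prod_type]
    simp_rw [← Finset.sum_smul, fun x => (hz x).2, one_smul]
    exact h.povm.2
  · have hb : ∀ s : X × Fin m, (∑ x, p x * W x s) * q s ^ a ≤
        c * ((r s.1 * z s.1 s.2) ^ (1 - a) * q s ^ a) := by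
      intro s
      have := hpush (fun _ => 1) s
      simp only [mul_one] at this
      rw [this, ← mul_assoc]
      refine mul_le_mul_of_nonneg_right ?_ (Real.rpow_nonneg (hq.1 s) _)
      by_cases hx : p s.1 = 0
      · rw [hx, zero_mul]
        exact mul_nonneg hc0.le
          (Real.rpow_nonneg (mul_nonneg (h.mem.1 _) ((hz _).1 _)) _)
      · rw [Real.mul_rpow (h.mem.1 _) ((hz _).1 _), ← mul_assoc, ← hNp _ hx, mul_assoc]
        exact mul_le_mul_of_nonneg_left ((huz _ hx).1 _) (hp.1 _)
    refine (Finset.sum_le_sum fun s _ => hb s).trans ?_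
    rw [← Finset.mul_sum]
    -- The refined weights are dominated by `c` times the `(1 - a)`-th power of the distribution `r
    -- x * z x i`.
    refine mul_le_of_le_one_right hc0.le (sum_rpow_mul_rpow_le_one ?_ hq ha.le ha1)
    refine ⟨fun s => mul_nonneg (h.mem.1 _) ((hz _).1 _), ?_⟩
    rw [Fintype.sum_prod_type]
    simp_rw [← Finset.mul_sum, fun x => (hz x).2, mul_one]
    exact h.mem.2
  · simp_rw [trace_relabel_mul, hpush]
    rw [Fintype.sum_prod_type, tiltedGain, Finset.mul_sum]
    refine Finset.sum_le_sum fun x _ => ?_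
    have hT := trace_mul_rpow_nonneg (hρ x).1 (h.povm.1 x) a
    simp_rw [fun i => trace_mul_rpow_smul (ρ x) (h.povm.1 x) ((hz x).1 i) a]
    by_cases hx : p x = 0
    · have hz0 := trace_mul_rpow_smul (ρ x) (h.povm.1 x) le_rfl a
      rw [Real.zero_rpow ha.ne', zero_mul, zero_smul] at hz0
      rw [(h.supp x hx).2, hz0, mul_zero, mul_zero]
      simp [hx]
    · rw [← mul_assoc, ← hNp x hx]
      calc _ ≤ p x * (∑ i, u x i * z x i ^ a) *
            (ρ x * cfc (fun t : ℝ => t ^ a) (M x)).trace.re :=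
          mul_le_mul_of_nonneg_right (mul_le_mul_of_nonneg_left (huz x hx).2 (hp.1 x)) hT
        _ = _ := by
          rw [Finset.mul_sum, Finset.sum_mul]
          exact Finset.sum_congr rfl fun i _ => by ring

/-- A strategy can be perturbed to one of full support. -/
lemma IsStrategy.exists_full_support {r : X → ℝ} {M : X → Matrix d d ℂ} (h : IsStrategy p r M)
    (hp : p ∈ stdSimplex ℝ X) (hρ : ∀ x, IsState (ρ x)) (ha : 0 < a) (ha1 : a ≤ 1)
    {t : ℝ} (ht : 0 < t) (ht1 : t < 1) :
    ∃ r', IsStrategy p r' M ∧ (∀ x, p x ≠ 0 → r' x ≠ 0) ∧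
      t * tiltedGain a ρ r M ≤ tiltedGain a ρ r' M := by
  refine ⟨fun x => t * r x + (1 - t) * p x, ⟨?_, h.povm, fun x hx => ⟨?_, (h.supp x hx).2⟩⟩,
    fun x hx => ?_, ?_⟩
  · exact convex_stdSimplex ℝ X h.mem hp ht.le (by linarith) (by ring)
  · simp [(h.supp x hx).1, hx]
  · have h1 := mul_nonneg ht.le (h.mem.1 x)
    have h2 := mul_pos (sub_pos.2 ht1) ((hp.1 x).lt_of_ne' hx)
    exact (by linarith : 0 < t * r x + (1 - t) * p x).ne'
  · rw [tiltedGain, tiltedGain, Finset.mul_sum]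
    refine Finset.sum_le_sum fun x _ => ?_
    rw [← mul_assoc]
    refine mul_le_mul_of_nonneg_right ?_ (trace_mul_rpow_nonneg (hρ x).1 (h.povm.1 x) a)
    have h0 := mul_nonneg ht.le (h.mem.1 x)
    -- Here `t ≤ t ^ (1 - a)` because `0 < t < 1`.
    calc t * r x ^ (1 - a) ≤ t ^ (1 - a) * r x ^ (1 - a) := by
          refine mul_le_mul_of_nonneg_right ?_ (Real.rpow_nonneg (h.mem.1 x) _)
          simpa using Real.rpow_le_rpow_of_exponent_ge ht ht1.le (by linarith : 1 - a ≤ 1)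
      _ = (t * r x) ^ (1 - a) := (Real.mul_rpow ht.le (h.mem.1 x)).symm
      _ ≤ _ := Real.rpow_le_rpow h0
          (le_add_of_nonneg_right (mul_nonneg (by linarith) (hp.1 x))) (by linarith)

end Lower

/-! ### The closed formula for orders above one. -/

section Formula

variable {X d : Type*} [Fintype X] [Fintype d] [DecidableEq d] {p : X → ℝ}
  {ρ : X → Matrix d d ℂ}

lemma gainExponent_pos {α : ℝ≥0∞} (hα : 1 < α) : 0 < gainExponent α := by
  rw [gainExponent]
  split_ifs with h
  · exact one_pos
  · have : 1 < α.toReal := by simpa using (ENNReal.toReal_lt_toReal ENNReal.one_ne_top h).2 hα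
    exact div_pos (by linarith) (by linarith)

lemma gainExponent_mono {α β : ℝ≥0∞} (hα : 1 < α) (h : α ≤ β) :
    gainExponent α ≤ gainExponent β := by
  by_cases hα' : α = ∞
  · rw [hα'] at h
    rw [hα', top_le_iff.1 h]
  have h1 : 1 < α.toReal := by
    simpa using (ENNReal.toReal_lt_toReal ENNReal.one_ne_top hα').2 hα
  by_cases hβ : β = ∞
  · rw [gainExponent, gainExponent, if_neg hα', if_pos hβ, div_le_one (by linarith)]
    linarith
  · have h2 : α.toReal ≤ β.toReal := (ENNReal.toReal_le_toReal hα' hβ).2 h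
    rw [gainExponent, gainExponent, if_neg hα', if_neg hβ, div_le_div_iff₀ (by linarith)
      (by linarith)]
    linarith

lemma gainExponent_le_one {α : ℝ≥0∞} (hα : 1 < α) : gainExponent α ≤ 1 := by
  have := gainExponent_mono hα le_top
  rwa [gainExponent, gainExponent, if_pos rfl] at this

section leakage

variable {S : Type*} [Fintype S] [DecidableEq S] {W : X → S → ℝ}

lemma maxGain_le (hp : p ∈ stdSimplex ℝ X) (hρ : ∀ x, IsState (ρ x)) {a : ℝ} (ha : 0 < a)
    (ha1 : a ≤ 1) (hW : ∀ x, W x ∈ stdSimplex ℝ S) :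
    maxGain a (relabel W (cqBlocks p ρ)) ≤
      priorGain a (fun s => ∑ x, p x * W x s) * gainCapacity a p ρ := by
  have h0 : 0 ≤ priorGain a (fun s => ∑ x, p x * W x s) * gainCapacity a p ρ :=
    mul_nonneg (priorGain_pos (pushforward_mem hp hW) ha ha1).le
      (zero_le_one.trans (one_le_gainCapacity hp hρ ha ha1))
  refine Real.iSup_le (fun M => ?_) h0
  rw [expectedGain_eq a _ M.2]
  exact sum_gain_le hp hρ ha ha1 hW M.2

/-- The capacity bound makes the set of gains bounded above, without which a real supremum would
carry no information. -/
lemma le_maxGain (hp : p ∈ stdSimplex ℝ X) (hρ : ∀ x, IsState (ρ x)) {a : ℝ} (ha : 0 < a)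
    (ha1 : a ≤ 1) (hW : ∀ x, W x ∈ stdSimplex ℝ S) {M : S → Matrix d d ℂ} (hM : IsPOVM M) :
    ∑ s, (relabel W (cqBlocks p ρ) s * cfc (fun t : ℝ => t ^ a) (M s)).trace.re ≤
      maxGain a (relabel W (cqBlocks p ρ)) := by
  rw [← expectedGain_eq a _ hM]
  refine le_ciSup (f := fun M : {M : S → Matrix d d ℂ // IsPOVM M} =>
    expectedGain a (relabel W (cqBlocks p ρ)) M.1)
    ⟨priorGain a (fun s => ∑ x, p x * W x s) * gainCapacity a p ρ, ?_⟩ ⟨M, hM⟩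
  rintro _ ⟨M, rfl⟩
  simp only
  rw [expectedGain_eq a _ M.2]
  exact sum_gain_le hp hρ ha ha1 hW M.2

lemma leakage_of_one_lt {α : ℝ≥0∞} (hα : 1 < α) (hρ : ∀ x, IsState (ρ x)) :
    leakage α (relabel W (cqBlocks p ρ)) = (((gainExponent α)⁻¹ *
      Real.log (maxGain (gainExponent α) (relabel W (cqBlocks p ρ)) /
        priorGain (gainExponent α) (fun s => ∑ x, p x * W x s)) : ℝ) : EReal) := by
  rw [leakage, if_neg hα.ne', classicalMarginal_relabel hρ]

omit [DecidableEq S] in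
lemma le_maxLeakage_of_gain {α : ℝ≥0∞} (hα : 1 < α) (hp : p ∈ stdSimplex ℝ X)
    (hρ : ∀ x, IsState (ρ x)) (hW : ∀ x, W x ∈ stdSimplex ℝ S) {M : S → Matrix d d ℂ}
    (hM : IsPOVM M) {c y : ℝ} (hc : 0 < c) (hy : 0 < y)
    (hprior : ∀ q ∈ stdSimplex ℝ S, ∑ s, (∑ x, p x * W x s) * q s ^ gainExponent α ≤ c)
    (hgain : c * y ≤ ∑ s,
      (relabel W (cqBlocks p ρ) s * cfc (fun t : ℝ => t ^ gainExponent α) (M s)).trace.re) :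
    (((gainExponent α)⁻¹ * Real.log y : ℝ) : EReal) ≤ maxLeakage α (cqBlocks p ρ) := by
  have ha := gainExponent_pos hα
  have ha1 := gainExponent_le_one hα
  set a := gainExponent α with ha_def
  let e := Fintype.equivFin S
  have hW' : ∀ x, (fun i => W x (e.symm i)) ∈ stdSimplex ℝ (Fin (Fintype.card S)) := fun x =>
    ⟨fun i => (hW x).1 _, by rw [e.symm.sum_comp (W x)]; exact (hW x).2⟩
  have hM' : IsPOVM fun i => M (e.symm i) :=
    ⟨fun i => hM.1 _, by rw [e.symm.sum_comp M]; exact hM.2⟩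
  refine le_trans ?_ (le_iSup_of_le (Fintype.card S) (le_iSup_of_le
    ⟨fun x i => W x (e.symm i), hW'⟩ le_rfl))
  rw [leakage_of_one_lt hα hρ, EReal.coe_le_coe_iff]
  refine mul_le_mul_of_nonneg_left (Real.log_le_log hy ?_) (inv_nonneg.2 ha.le)
  have hpush := pushforward_mem hp hW'
  have hpos := priorGain_pos hpush ha ha1
  rw [le_div_iff₀ hpos]
  have hle : priorGain a (fun i => ∑ x, p x * W x (e.symm i)) ≤ c := by
    refine Real.iSup_le (fun q => ?_) hc.le
    have := hprior (fun s => q.1 (e s))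
      ⟨fun s => q.2.1 _, by rw [e.sum_comp q.1]; exact q.2.2⟩
    rw [← e.symm.sum_comp] at this
    simp only [Equiv.apply_symm_apply] at this
    exact this
  refine le_trans ?_ (le_maxGain hp hρ ha ha1 hW' hM')
  rw [← e.symm.sum_comp] at hgain
  calc _ ≤ y * c := mul_le_mul_of_nonneg_left hle hy.le
    _ = c * y := mul_comm _ _
    _ ≤ _ := hgain

end leakage

/-- The maximal `α`-leakage is a Rényi capacity. -/
theorem maxLeakage_eq_log_gainCapacity {α : ℝ≥0∞} (hα : 1 < α) (hp : p ∈ stdSimplex ℝ X)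
    (hρ : ∀ x, IsState (ρ x)) :
    maxLeakage α (cqBlocks p ρ) =
      (((gainExponent α)⁻¹ * Real.log (gainCapacity (gainExponent α) p ρ) : ℝ) : EReal) := by
  classical
  have ha := gainExponent_pos hα
  have ha1 := gainExponent_le_one hα
  have hC := one_le_gainCapacity hp hρ ha ha1
  refine le_antisymm (iSup₂_le fun n W => ?_) ?_
  · rw [leakage_of_one_lt hα hρ, EReal.coe_le_coe_iff]
    refine mul_le_mul_of_nonneg_left ?_ (inv_nonneg.2 ha.le)
    have hpos := priorGain_pos (pushforward_mem hp W.2) ha ha1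
    have hle := (div_le_iff₀' hpos).2 (maxGain_le hp hρ ha ha1 W.2)
    rcases lt_or_ge 0 (maxGain (gainExponent α) (relabel W.1 (cqBlocks p ρ)) /
        priorGain (gainExponent α) fun s => ∑ x, p x * W.1 x s) with h0 | h0
    · exact Real.log_le_log h0 hle
    -- A nonpositive ratio must be `0`, where `Real.log` is `0` by convention, so positivity of the
    -- maximal gain is not needed.
    · have hnn : 0 ≤ maxGain (gainExponent α) (relabel W.1 (cqBlocks p ρ)) := by
        refine Real.iSup_nonneg fun M => ?_
        rw [expectedGain_eq _ _ M.2]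
        refine Finset.sum_nonneg fun s _ => trace_mul_rpow_nonneg ?_ (M.2.1 s) _
        exact Matrix.posSemidef_sum _ fun x _ => posSemidef_real_smul
          (posSemidef_real_smul (hρ x).1 (hp.1 x)) ((W.2 x).1 s)
      rw [le_antisymm h0 (div_nonneg hnn hpos.le), Real.log_zero]
      exact Real.log_nonneg hC
  · refine EReal.ge_of_forall_gt_iff_ge.1 fun c hc => ?_
    rw [EReal.coe_lt_coe_iff] at hc
    set y := Real.exp (gainExponent α * c) with hy
    have hyC : y < gainCapacity (gainExponent α) p ρ := by
      rw [hy, ← Real.lt_log_iff_exp_lt (by linarith)]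
      have := mul_lt_mul_of_pos_left hc ha
      rwa [← mul_assoc, mul_inv_cancel₀ ha.ne', one_mul] at this
    have hy0 : 0 < y := Real.exp_pos _
    obtain ⟨_, ⟨r, M, hstr, rfl⟩, hlt⟩ := exists_lt_of_lt_csSup (tiltedGains_nonempty hp) hyC
    have hG := hy0.trans hlt
    -- The mixing parameter `y / tiltedGain` lies in `(0, 1)` and leaves a perturbed strategy of
    -- value at least `y`.
    obtain ⟨r', hstr', hfull, hle⟩ := hstr.exists_full_support hp hρ ha ha1
      (div_pos hy0 hG) ((div_lt_one hG).2 hlt)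
    rw [div_mul_cancel₀ _ hG.ne'] at hle
    obtain ⟨m, W, K, e, hW, hK, he, hprior, hgain⟩ :=
      hstr'.exists_refinement hp hρ ha ha1 hfull
    have := le_maxLeakage_of_gain hα hp hρ hW hK he hy0 hprior
      ((mul_le_mul_of_nonneg_left hle he.le).trans hgain)
    rw [hy, Real.log_exp, ← mul_assoc, inv_mul_cancel₀ ha.ne', one_mul] at this
    exact this

end Formula

/-! ### The logarithmic capacity and the upper bound at order one. -/

section LogCapacity

variable {X d : Type*} [Fintype X] [Fintype d] [DecidableEq d]

/-- POVMs on `X` that are positive definite on the support of `p` and vanish off it. -/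
structure IsLogStrategy (p : X → ℝ) (M : X → Matrix d d ℂ) : Prop where
  povm : IsPOVM M
  supp : ∀ x, p x = 0 → M x = 0
  posDef : ∀ x, p x ≠ 0 → (M x).PosDef

/-- The decrease of the expected log-loss achieved by the POVM `M`. -/
noncomputable def logGain (p : X → ℝ) (ρ : X → Matrix d d ℂ) (M : X → Matrix d d ℂ) : ℝ :=
  ∑ x, p x * ((ρ x * cfc Real.log (M x)).trace.re - Real.log (p x))

/-- The values of `logGain` over all log-strategies. -/
def logGains (p : X → ℝ) (ρ : X → Matrix d d ℂ) : Set ℝ :=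
  {g | ∃ M, IsLogStrategy p M ∧ logGain p ρ M = g}

/-- The supremum of the log-gains, a measured mutual information. -/
noncomputable def logCapacity (p : X → ℝ) (ρ : X → Matrix d d ℂ) : ℝ :=
  sSup (logGains p ρ)

variable {p : X → ℝ} {ρ : X → Matrix d d ℂ}

lemma shannonEntropy_eq {S : Type*} [Fintype S] (p : S → ℝ) :
    shannonEntropy p = -∑ s, p s * Real.log (p s) := by
  simp [shannonEntropy, Real.negMulLog]

lemma IsLogStrategy.logGain_le {M : X → Matrix d d ℂ} (h : IsLogStrategy p M)
    (hp : p ∈ stdSimplex ℝ X) (hρ : ∀ x, IsState (ρ x)) : logGain p ρ M ≤ shannonEntropy p := by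
  classical
  rw [shannonEntropy_eq, ← Finset.sum_neg_distrib]
  refine Finset.sum_le_sum fun x _ => ?_
  by_cases hx : p x = 0
  · simp [hx]
  · have h1 := trace_mul_log_le (hρ x) (h.posDef x hx)
    have h2 := Real.log_nonpos (trace_mul_pos (hρ x) (h.posDef x hx)).le
      (trace_mul_le_one (hρ x) (h.povm.one_sub x))
    have := mul_nonpos_of_nonneg_of_nonpos (hp.1 x) (h1.trans h2)
    rw [mul_sub]
    linarith

lemma IsLogStrategy.le_logCapacity {M : X → Matrix d d ℂ} (h : IsLogStrategy p M)
    (hp : p ∈ stdSimplex ℝ X) (hρ : ∀ x, IsState (ρ x)) : logGain p ρ M ≤ logCapacity p ρ := by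
  refine le_csSup ⟨shannonEntropy p, ?_⟩ ⟨M, h, rfl⟩
  rintro _ ⟨M, h, rfl⟩
  exact h.logGain_le hp hρ

lemma IsLogStrategy.smul_one (hp : p ∈ stdSimplex ℝ X) :
    IsLogStrategy p fun x => p x • (1 : Matrix d d ℂ) :=
  ⟨isPOVM_smul_one hp, fun x hx => by simp [hx],
    fun x hx => posDef_real_smul Matrix.PosDef.one ((hp.1 x).lt_of_ne' hx)⟩

lemma logGains_nonempty (hp : p ∈ stdSimplex ℝ X) : (logGains p ρ).Nonempty :=
  ⟨_, _, .smul_one hp, rfl⟩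

lemma logCapacity_le (hp : p ∈ stdSimplex ℝ X) (hρ : ∀ x, IsState (ρ x)) :
    logCapacity p ρ ≤ shannonEntropy p := by
  refine csSup_le (logGains_nonempty hp) ?_
  rintro _ ⟨M, h, rfl⟩
  exact h.logGain_le hp hρ

lemma logCapacity_nonneg (hp : p ∈ stdSimplex ℝ X) (hρ : ∀ x, IsState (ρ x)) :
    0 ≤ logCapacity p ρ := by
  refine le_trans (le_of_eq ?_) ((IsLogStrategy.smul_one hp).le_logCapacity hp hρ)
  refine (Finset.sum_eq_zero fun x _ => ?_).symm
  by_cases hx : p x = 0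
  · simp [hx]
  · rw [trace_mul_log_smul (hρ x) Matrix.PosDef.one ((hp.1 x).lt_of_ne' hx), cfc_apply_one]
    simp

omit [Fintype d] [DecidableEq d] in
lemma posDef_sum_of_mem {ι : Type*} [Fintype ι] {B : ι → Matrix d d ℂ}
    (hB : ∀ i, (B i).PosSemidef) {i : ι} (hi : (B i).PosDef) : (∑ i, B i).PosDef := by
  classical
  rw [← Finset.add_sum_erase _ _ (Finset.mem_univ i)]
  exact hi.add_posSemidef (Matrix.posSemidef_sum _ fun j _ => hB j)

/-- Guessing a function of `X` reduces the log-loss by at most the capacity. -/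
lemma sum_log_le {S : Type*} [Fintype S] {W : X → S → ℝ} (hp : p ∈ stdSimplex ℝ X)
    (hρ : ∀ x, IsState (ρ x)) (hW : ∀ x, W x ∈ stdSimplex ℝ S) {M : S → Matrix d d ℂ}
    (hM : IsPOVM M) (hpd : ∀ s, (M s).PosDef) :
    ∑ s, (relabel W (cqBlocks p ρ) s * cfc Real.log (M s)).trace.re +
      shannonEntropy (fun s => ∑ x, p x * W x s) ≤ logCapacity p ρ := by
  set v : S → ℝ := fun s => ∑ x, p x * W x s with hv
  have hvm : v ∈ stdSimplex ℝ S := pushforward_mem hp hW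
  set P := posterior p W with hP
  have hPm : ∀ s, P s ∈ stdSimplex ℝ X := posterior_mem hp hW
  have hvP : ∀ s x, v s * P s x = p x * W x s := mul_posterior hp hW
  have hPpos : ∀ x s, p x * W x s ≠ 0 → 0 < P s x := fun x s h =>
    ((hPm s).1 x).lt_of_ne' (right_ne_zero_of_mul ((hvP s x).trans_ne h))
  have hpsd : ∀ x s, (P s x • M s).PosSemidef := fun x s =>
    posSemidef_real_smul (hM.1 s) ((hPm s).1 x)
  have hposdef : ∀ x s, p x * W x s ≠ 0 → (P s x • M s).PosDef := fun x s h =>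
    posDef_real_smul (hpd s) (hPpos x s h)
  have hstr : IsLogStrategy p fun x => ∑ s, P s x • M s := by
    refine ⟨hM.posterior_sum hPm, fun x hx => by simp [hP, posterior_eq_zero hx], fun x hx => ?_⟩
    obtain ⟨s, hs⟩ := exists_ne_zero_of_mem_stdSimplex (hW x)
    exact posDef_sum_of_mem (hpsd x) (hposdef x s (mul_ne_zero hx hs))
  refine le_trans (le_of_eq ?_) ((Finset.sum_le_sum (f := fun x => ∑ s, p x * W x s *
      ((ρ x * cfc Real.log (P s x • M s)).trace.re - Real.log (p x * W x s))) fun x _ => ?_).trans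
    (hstr.le_logCapacity hp hρ))
  -- Bayes' rule `v s * P s x = p x * W x s` cancels the posterior: `log P - log (p W) = -log v`,
  -- and summing over `x` leaves the log-loss terms and the entropy of `v`.
  · have hterm : ∀ x s, p x * W x s *
        ((ρ x * cfc Real.log (P s x • M s)).trace.re - Real.log (p x * W x s)) =
        p x * W x s * (ρ x * cfc Real.log (M s)).trace.re - p x * W x s * Real.log (v s) := by
      intro x s
      by_cases h : p x * W x s = 0
      · simp [h]
      · have hv0 : v s ≠ 0 := left_ne_zero_of_mul ((hvP s x).trans_ne h)
        rw [trace_mul_log_smul (hρ x) (hpd s) (hPpos x s h), ← hvP s x,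
          Real.log_mul hv0 (hPpos x s h).ne']
        ring
    simp_rw [hterm, Finset.sum_sub_distrib, trace_relabel_mul]
    rw [Finset.sum_comm, shannonEntropy_eq, sub_eq_add_neg]
    congr 2
    rw [Finset.sum_comm]
    exact Finset.sum_congr rfl fun s _ => Finset.sum_mul ..
  · have := sum_perspective_log_le (hρ x) (r := fun s => p x * W x s)
      (fun s => mul_nonneg (hp.1 x) ((hW x).1 s)) (hpsd x) (hposdef x)
    rwa [← Finset.mul_sum, (hW x).2, mul_one] at this

end LogCapacity

/-! ### Log-loss, kernels, and the formula at order one. -/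

section LogLoss

variable {S d : Type*} [Fintype S] [DecidableEq S] [Fintype d] [DecidableEq d]

/-- Mixing a POVM with white noise costs at most `- log (1 - ε)` in log-loss. -/
lemma trace_mul_log_le_mix {A M : Matrix d d ℂ} (hA : A.PosSemidef) (hM : M.PosSemidef)
    (hker : LinearMap.ker M.mulVecLin ≤ LinearMap.ker A.mulVecLin) {t δ : ℝ} (ht : 0 < t)
    (hδ : 0 ≤ δ) :
    (A * cfc Real.log M).trace.re + Real.log t * A.trace.re ≤
      (A * cfc Real.log (t • M + δ • (1 : Matrix d d ℂ))).trace.re := by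
  obtain ⟨w, hw, hw1, h, hz⟩ := exists_spectral_weights hA hM.isHermitian
  have hfin := Matrix.finite_real_spectrum (A := M)
  have hsa := hM.isHermitian.isSelfAdjoint
  have hcfc : cfc (fun s : ℝ => Real.log (t * s + δ)) M =
      cfc Real.log (t • M + δ • (1 : Matrix d d ℂ)) := by
    rw [cfc_comp' Real.log (fun s : ℝ => t * s + δ) M ((hfin.image _).continuousOn _)
      (by fun_prop) hsa, cfc_add M (fun s : ℝ => t * s) (fun _ => δ), cfc_const_mul_id t M hsa,
      cfc_const δ M hsa, Algebra.algebraMap_eq_smul_one]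
  rw [← hcfc, h, h, ← hw1, Finset.mul_sum, ← Finset.sum_add_distrib]
  refine Finset.sum_le_sum fun i _ => ?_
  -- Zero eigenvalues carry no weight by the kernel condition; for the others `log (t * l + δ) ≥ log
  -- t + log l`.
  rcases (hM.eigenvalues_nonneg i).eq_or_lt with h0 | h0
  · simp [hz hker i h0.symm]
  · rw [mul_comm (Real.log t), ← mul_add, add_comm, ← Real.log_mul ht.ne' h0.ne']
    refine mul_le_mul_of_nonneg_left (Real.log_le_log (mul_pos ht h0) ?_) (hw i)
    linarith

variable {X : Type*} [Fintype X] {p : X → ℝ} {ρ : X → Matrix d d ℂ} {W : X → S → ℝ}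

omit [DecidableEq S] [DecidableEq d] in
lemma relabel_posSemidef (hp : p ∈ stdSimplex ℝ X) (hρ : ∀ x, IsState (ρ x))
    (hW : ∀ x, W x ∈ stdSimplex ℝ S) (s : S) : (relabel W (cqBlocks p ρ) s).PosSemidef :=
  Matrix.posSemidef_sum _ fun x _ => posSemidef_real_smul
    (posSemidef_real_smul (hρ x).1 (hp.1 x)) ((hW x).1 s)

lemma sum_log_le_of_ker_le (hp : p ∈ stdSimplex ℝ X) (hρ : ∀ x, IsState (ρ x))
    (hW : ∀ x, W x ∈ stdSimplex ℝ S) {M : S → Matrix d d ℂ} (hM : IsPOVM M)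
    (hker : LinearMap.ker (Matrix.blockDiagonal M).mulVecLin ≤
      LinearMap.ker (Matrix.blockDiagonal (relabel W (cqBlocks p ρ))).mulVecLin) :
    (Matrix.blockDiagonal (relabel W (cqBlocks p ρ)) *
        cfc Real.log (Matrix.blockDiagonal M)).trace.re +
      shannonEntropy (fun s => ∑ x, p x * W x s) ≤ logCapacity p ρ := by
  set τ := relabel W (cqBlocks p ρ) with hτ
  have hvm := pushforward_mem hp hW
  obtain ⟨s₀, -⟩ := exists_ne_zero_of_mem_stdSimplex hvm
  have : Nonempty S := ⟨s₀⟩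
  have hcard : (0 : ℝ) < Fintype.card S := Nat.cast_pos.2 Fintype.card_pos
  have hτp := relabel_posSemidef hp hρ hW
  have htr : (Matrix.blockDiagonal τ).trace.re = 1 := by
    rw [Matrix.trace_blockDiagonal, Complex.re_sum, ← hvm.2]
    exact Finset.sum_congr rfl fun s _ => congrFun (classicalMarginal_relabel hρ W) s
  set L := (Matrix.blockDiagonal τ * cfc Real.log (Matrix.blockDiagonal M)).trace.re +
    shannonEntropy (fun s => ∑ x, p x * W x s) with hL
  -- Mixing `M` with the uniform guess makes all its blocks positive definite, as `sum_log_le`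
  -- requires, at the price `log t`; afterwards `t = exp (-ε)` tends to `1`.
  have key : ∀ t : ℝ, 0 < t → t < 1 → L + Real.log t ≤ logCapacity p ρ := by
    intro t ht ht1
    set δ := (1 - t) / Fintype.card S with hδ
    have hδ0 : 0 < δ := div_pos (by linarith) hcard
    have h1 := trace_mul_log_le_mix (posSemidef_blockDiagonal hτp)
      (posSemidef_blockDiagonal hM.1) hker ht hδ0.le
    set K : S → Matrix d d ℂ := fun s => t • M s + δ • (1 : Matrix d d ℂ) with hK
    have hKpd : ∀ s, (K s).PosDef := fun s =>
      (posDef_real_smul Matrix.PosDef.one hδ0).posSemidef_add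
        (posSemidef_real_smul (hM.1 s) ht.le)
    have hKm : IsPOVM K := by
      refine ⟨fun s => (hKpd s).posSemidef, ?_⟩
      simp only [hK, Finset.sum_add_distrib, ← Finset.smul_sum, hM.2, Finset.sum_const,
        Finset.card_univ]
      rw [← Nat.cast_smul_eq_nsmul ℝ, smul_smul, ← add_smul, hδ, div_mul_cancel₀ _ hcard.ne']
      simp
    have hKb : t • Matrix.blockDiagonal M + δ • 1 = Matrix.blockDiagonal K := by
      rw [← Matrix.blockDiagonal_smul, ← Matrix.blockDiagonal_one, ← Matrix.blockDiagonal_smul,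
        ← Matrix.blockDiagonal_add]
      rfl
    rw [hKb, htr, mul_one, trace_blockDiagonal_mul_cfc Real.log τ
      fun s => (hKm.1 s).isHermitian] at h1
    have h2 := sum_log_le hp hρ hW hKm hKpd
    linarith
  refine le_of_forall_pos_sub_le fun ε hε => ?_
  have := key (Real.exp (-ε)) (Real.exp_pos _) (by simpa using hε)
  rw [Real.log_exp] at this
  linarith

lemma entropy_sub_le_minLogLoss (hp : p ∈ stdSimplex ℝ X) (hρ : ∀ x, IsState (ρ x))
    (hW : ∀ x, W x ∈ stdSimplex ℝ S) :
    ((shannonEntropy (fun s => ∑ x, p x * W x s) - logCapacity p ρ : ℝ) : EReal) ≤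
      minLogLoss (relabel W (cqBlocks p ρ)) := by
  refine le_iInf fun M => ?_
  rw [expectedLogLoss]
  split_ifs with h
  · rw [EReal.coe_le_coe_iff]
    linarith [sum_log_le_of_ker_le hp hρ hW M.2 h]
  · exact le_top

-- Gibbs' inequality, from `log y ≤ y - 1`; the optimal guess is `v` itself.
omit [DecidableEq S] in
lemma priorLogLoss_eq {v : S → ℝ} (hv : v ∈ stdSimplex ℝ S) :
    priorLogLoss v = ((shannonEntropy v : ℝ) : EReal) := by
  refine le_antisymm ?_ (le_iInf fun q => ?_)
  · refine (iInf_le _ ⟨v, hv⟩).trans ?_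
    split_ifs with h
    · rw [shannonEntropy_eq]
      exact le_rfl
    · exact absurd (fun x hx => hx) h
  · split_ifs with h
    · rw [EReal.coe_le_coe_iff, shannonEntropy_eq, neg_le_neg_iff, ← sub_nonpos,
        ← Finset.sum_sub_distrib]
      have hterm : ∀ s, v s * Real.log ((q : S → ℝ) s) - v s * Real.log (v s) ≤
          (q : S → ℝ) s - v s := by
        intro s
        rcases (hv.1 s).eq_or_lt with h0 | h0
        · simp [← h0]
        · have hq : 0 < (q : S → ℝ) s := (q.2.1 s).lt_of_ne' fun h' => h0.ne' (h s h')
          rw [← mul_sub, ← Real.log_div hq.ne' h0.ne']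
          have := mul_le_mul_of_nonneg_left (Real.log_le_sub_one_of_pos (div_pos hq h0)) h0.le
          rwa [mul_sub, mul_div_cancel₀ _ h0.ne', mul_one] at this
      refine (Finset.sum_le_sum fun s _ => hterm s).trans (le_of_eq ?_)
      rw [Finset.sum_sub_distrib]
      exact sub_eq_zero.2 (q.2.2.trans hv.2.symm)
    · exact le_top

/-- The maximal `1`-leakage is a measured mutual information. -/
theorem maxLeakage_one_eq_logCapacity (hp : p ∈ stdSimplex ℝ X) (hρ : ∀ x, IsState (ρ x)) :
    maxLeakage 1 (cqBlocks p ρ) = ((logCapacity p ρ : ℝ) : EReal) := by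
  classical
  have hleak : ∀ (n : ℕ) (W : X → Fin n → ℝ), (∀ x, W x ∈ stdSimplex ℝ (Fin n)) →
      leakage 1 (relabel W (cqBlocks p ρ)) =
        ((shannonEntropy (fun s => ∑ x, p x * W x s) : ℝ) : EReal) -
          minLogLoss (relabel W (cqBlocks p ρ)) := by
    intro n W hW
    rw [leakage, if_pos rfl, classicalMarginal_relabel hρ, priorLogLoss_eq (pushforward_mem hp hW)]
  refine le_antisymm (iSup₂_le fun n W => ?_) ?_
  · rw [hleak n W.1 W.2]
    refine (EReal.sub_le_sub le_rfl (entropy_sub_le_minLogLoss hp hρ W.2)).trans ?_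
    rw [← EReal.coe_sub, sub_sub_cancel]
  · refine EReal.ge_of_forall_gt_iff_ge.1 fun c hc => ?_
    rw [EReal.coe_lt_coe_iff] at hc
    obtain ⟨_, ⟨M, hM, rfl⟩, hlt⟩ := exists_lt_of_lt_csSup (logGains_nonempty hp) hc
    let e := Fintype.equivFin X
    -- The optimal `S` is `X` itself, relabelled by `Fin`.
    set W : X → Fin (Fintype.card X) → ℝ := fun x => Pi.single (e x) 1 with hW
    have hWm : ∀ x, W x ∈ stdSimplex ℝ (Fin (Fintype.card X)) := fun x =>
      single_mem_stdSimplex ℝ _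
    refine le_trans ?_ (le_iSup_of_le (Fintype.card X) (le_iSup_of_le ⟨W, hWm⟩ le_rfl))
    have hrel : relabel W (cqBlocks p ρ) = fun i => cqBlocks p ρ (e.symm i) := by
      funext i
      rw [relabel, Finset.sum_eq_single (e.symm i)]
      · simp [hW]
      · intro x _ hx
        have : i ≠ e x := fun h => hx (by simp [h])
        simp [hW, this]
      · simp
    have hpush : (fun s => ∑ x, p x * W x s) = fun i => p (e.symm i) := by
      funext i
      rw [Finset.sum_eq_single (e.symm i)]
      · simp [hW]
      · intro x _ hx
        have : i ≠ e x := fun h => hx (by simp [h])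
        simp [hW, this]
      · simp
    have hent : shannonEntropy (fun i => p (e.symm i)) = shannonEntropy p :=
      e.symm.sum_comp fun x => Real.negMulLog (p x)
    rw [hleak _ _ hWm, hpush, hent, hrel]
    have hKm : IsPOVM fun i => M (e.symm i) :=
      ⟨fun i => hM.povm.1 _, by rw [e.symm.sum_comp M]; exact hM.povm.2⟩
    have hker : LinearMap.ker (Matrix.blockDiagonal fun i => M (e.symm i)).mulVecLin ≤
        LinearMap.ker (Matrix.blockDiagonal fun i => cqBlocks p ρ (e.symm i)).mulVecLin := by
      have hmul : ∀ (B : Fin (Fintype.card X) → Matrix d d ℂ) (v : d × Fin (Fintype.card X) → ℂ)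
          (j : d) (i : Fin (Fintype.card X)), (Matrix.blockDiagonal B).mulVec v (j, i) =
            (B i).mulVec (fun k => v (k, i)) j := by
        intro B v j i
        simp [Matrix.mulVec, dotProduct, Fintype.sum_prod_type, Matrix.blockDiagonal_apply]
      intro v hv
      rw [LinearMap.mem_ker, Matrix.mulVecLin_apply] at hv ⊢
      funext ⟨j, i⟩
      rw [hmul]
      have hvi : (M (e.symm i)).mulVec (fun k => v (k, i)) = 0 := by
        funext k
        rw [← hmul (fun i => M (e.symm i)), hv]
        rfl
      by_cases hx : p (e.symm i) = 0
      · simp [cqBlocks, hx]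
      · have hu := Matrix.mulVec_injective_of_isUnit (hM.posDef _ hx).isUnit
        have h0 : (fun k => v (k, i)) = 0 := hu (hvi.trans (Matrix.mulVec_zero _).symm)
        simp [h0]
    have hmin : minLogLoss (fun i => cqBlocks p ρ (e.symm i)) ≤
        ((shannonEntropy p - logGain p ρ M : ℝ) : EReal) := by
      refine (iInf_le _ ⟨_, hKm⟩).trans ?_
      rw [expectedLogLoss, if_pos hker, EReal.coe_le_coe_iff, trace_blockDiagonal_mul_cfc _ _
        fun i => (hKm.1 i).isHermitian, e.symm.sum_comp fun x =>
          (cqBlocks p ρ x * cfc Real.log (M x)).trace.re, shannonEntropy_eq, logGain]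
      refine le_of_eq ?_
      simp only [mul_sub, Finset.sum_sub_distrib, cqBlocks]
      simp only [smul_mul_assoc, Matrix.trace_smul, Complex.real_smul, Complex.re_ofReal_mul]
      ring
    refine le_trans ?_ (EReal.sub_le_sub le_rfl hmin)
    rw [← EReal.coe_sub, sub_sub_cancel, EReal.coe_le_coe_iff]
    exact hlt.le

end LogLoss

/-! ### Concavity, quasi-convexity, monotonicity in the order, and bounds. -/

section Properties

variable {X d : Type*} [Fintype X] [Fintype d] [DecidableEq d] {p q : X → ℝ}
  {ρ σ : X → Matrix d d ℂ} {a b : ℝ}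

omit [DecidableEq d] in
lemma isState_convexComb {A B : Matrix d d ℂ} (hA : IsState A) (hB : IsState B) (ha : 0 ≤ a)
    (hb : 0 ≤ b) (hab : a + b = 1) : IsState (a • A + b • B) := by
  refine ⟨(posSemidef_real_smul hA.1 ha).add (posSemidef_real_smul hB.1 hb), ?_⟩
  rw [Matrix.trace_add, Matrix.trace_smul, Matrix.trace_smul, hA.2, hB.2, ← add_smul, hab,
    one_smul]

lemma gainCapacity_mono_support (hp : p ∈ stdSimplex ℝ X) (hρ : ∀ x, IsState (ρ x)) (ha : 0 < a)
    (ha1 : a ≤ 1) (hpq : ∀ x, q x = 0 → p x = 0) :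
    gainCapacity a p ρ ≤ gainCapacity a q ρ := by
  refine csSup_le (tiltedGains_nonempty hp) ?_
  rintro _ ⟨r, M, h, rfl⟩
  have h' : IsStrategy q r M := ⟨h.mem, h.povm, fun x hx => h.supp x (hpq x hx)⟩
  exact h'.le_gainCapacity hρ ha ha1

lemma logGain_term_smul (hρ : ∀ x, IsState (ρ x)) {M : X → Matrix d d ℂ}
    (hM : IsLogStrategy p M) (ha : 0 < a) (x : X) :
    a * p x * ((ρ x * cfc Real.log (a • M x)).trace.re - Real.log (a * p x)) =
      a * (p x * ((ρ x * cfc Real.log (M x)).trace.re - Real.log (p x))) := by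
  by_cases hx : p x = 0
  · simp [hx]
  · rw [trace_mul_log_smul (hρ x) (hM.posDef x hx) ha, Real.log_mul ha.ne' hx]
    ring

/-- Strategies `M` for `p` and `N` for `q` combine to `a • M + b • N` for the mixture, and
superadditivity of the logarithmic perspective compares the values. -/
lemma logCapacity_concave (hp : p ∈ stdSimplex ℝ X) (hq : q ∈ stdSimplex ℝ X)
    (hρ : ∀ x, IsState (ρ x)) (ha : 0 < a) (hb : 0 < b) (hab : a + b = 1) :
    a * logCapacity p ρ + b * logCapacity q ρ ≤ logCapacity (a • p + b • q) ρ := by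
  have hpq : a • p + b • q ∈ stdSimplex ℝ X := convex_stdSimplex ℝ X hp hq ha.le hb.le hab
  have key : ∀ M N, IsLogStrategy p M → IsLogStrategy q N →
      a * logGain p ρ M + b * logGain q ρ N ≤ logCapacity (a • p + b • q) ρ := by
    intro M N hM hN
    have hpsd : ∀ x, ∀ i : Fin 2, (![a • M x, b • N x] i).PosSemidef := by
      intro x i
      fin_cases i
      exacts [posSemidef_real_smul (hM.povm.1 x) ha.le, posSemidef_real_smul (hN.povm.1 x) hb.le]
    have hpd : ∀ x, ∀ i : Fin 2, ![a * p x, b * q x] i ≠ 0 →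
        (![a • M x, b • N x] i).PosDef := by
      intro x i
      fin_cases i
      · exact fun h => posDef_real_smul (hM.posDef x (right_ne_zero_of_mul h)) ha
      · exact fun h => posDef_real_smul (hN.posDef x (right_ne_zero_of_mul h)) hb
    have hstr : IsLogStrategy (a • p + b • q) fun x => ∑ i, ![a • M x, b • N x] i := by
      refine ⟨⟨fun x => Matrix.posSemidef_sum _ fun i _ => hpsd x i, ?_⟩, fun x hx => ?_,
        fun x hx => ?_⟩
      · simp only [Fin.sum_univ_two, Matrix.cons_val_zero, Matrix.cons_val_one,
          Finset.sum_add_distrib, ← Finset.smul_sum, hM.povm.2, hN.povm.2]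
        rw [← add_smul, hab, one_smul]
      · have h1 := mul_nonneg ha.le (hp.1 x)
        have h2 := mul_nonneg hb.le (hq.1 x)
        simp only [Pi.add_apply, Pi.smul_apply, smul_eq_mul] at hx
        have hpx : p x = 0 := (mul_eq_zero.1 (by linarith : a * p x = 0)).resolve_left ha.ne'
        have hqx : q x = 0 := (mul_eq_zero.1 (by linarith : b * q x = 0)).resolve_left hb.ne'
        simp [Fin.sum_univ_two, hM.supp x hpx, hN.supp x hqx]
      · by_cases hpx : p x = 0
        · by_cases hqx : q x = 0
          · simp [hpx, hqx] at hx
          · exact posDef_sum_of_mem (hpsd x) (hpd x 1 (mul_ne_zero hb.ne' hqx))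
        · exact posDef_sum_of_mem (hpsd x) (hpd x 0 (mul_ne_zero ha.ne' hpx))
    refine le_trans ?_ (hstr.le_logCapacity hpq hρ)
    rw [logGain, logGain, logGain, Finset.mul_sum, Finset.mul_sum, ← Finset.sum_add_distrib]
    refine Finset.sum_le_sum fun x _ => ?_
    have := sum_perspective_log_le (hρ x) (r := ![a * p x, b * q x])
      (fun i => by
        fin_cases i
        exacts [mul_nonneg ha.le (hp.1 x), mul_nonneg hb.le (hq.1 x)]) (hpsd x) (hpd x)
    rw [Fin.sum_univ_two (f := ![a * p x, b * q x]), Fin.sum_univ_two] at this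
    simp only [Matrix.cons_val_zero, Matrix.cons_val_one] at this
    rwa [logGain_term_smul hρ hM ha, logGain_term_smul hρ hN hb] at this
  have h1 : ∀ M, IsLogStrategy p M →
      a * logGain p ρ M + b * logCapacity q ρ ≤ logCapacity (a • p + b • q) ρ := by
    intro M hM
    rw [← le_sub_iff_add_le', ← le_div_iff₀' hb]
    refine csSup_le (logGains_nonempty hq) ?_
    rintro _ ⟨N, hN, rfl⟩
    rw [le_div_iff₀' hb, le_sub_iff_add_le']
    exact key M N hM hN
  rw [← le_sub_iff_add_le, ← le_div_iff₀' ha]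
  refine csSup_le (logGains_nonempty hp) ?_
  rintro _ ⟨M, hM, rfl⟩
  rw [le_div_iff₀' ha, le_sub_iff_add_le]
  exact h1 M hM

/-- Concavity of the maximal leakage in the distribution. -/
theorem concaveOn_maxLeakage {α : ℝ≥0∞} (hα : 1 ≤ α) (hρ : ∀ x, IsState (ρ x)) :
    ConcaveOn ℝ (stdSimplex ℝ X) fun p => (maxLeakage α (cqBlocks p ρ)).toReal := by
  refine concaveOn_iff_forall_pos.2 ⟨convex_stdSimplex ℝ X, fun p hp q hq s t hs ht hst => ?_⟩
  have hpq : s • p + t • q ∈ stdSimplex ℝ X := convex_stdSimplex ℝ X hp hq hs.le ht.le hst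
  simp only [smul_eq_mul]
  rcases hα.eq_or_lt with rfl | hα
  · rw [maxLeakage_one_eq_logCapacity hp hρ, maxLeakage_one_eq_logCapacity hq hρ,
      maxLeakage_one_eq_logCapacity hpq hρ]
    exact logCapacity_concave hp hq hρ hs ht hst
  · rw [maxLeakage_eq_log_gainCapacity hα hp hρ, maxLeakage_eq_log_gainCapacity hα hq hρ,
      maxLeakage_eq_log_gainCapacity hα hpq hρ]
    simp only [EReal.toReal_coe]
    have ha := gainExponent_pos hα
    have ha1 := gainExponent_le_one hα
    -- Only supports matter here: that of the mixture contains both others, so its capacity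
    -- dominates both.
    have hlog : ∀ p' ∈ stdSimplex ℝ X, (∀ x, (s • p + t • q) x = 0 → p' x = 0) →
        (gainExponent α)⁻¹ * Real.log (gainCapacity (gainExponent α) p' ρ) ≤
          (gainExponent α)⁻¹ * Real.log (gainCapacity (gainExponent α) (s • p + t • q) ρ) :=
      fun p' hp' h => mul_le_mul_of_nonneg_left (Real.log_le_log
        (zero_lt_one.trans_le (one_le_gainCapacity hp' hρ ha ha1))
        (gainCapacity_mono_support hp' hρ ha ha1 h)) (inv_nonneg.2 ha.le)
    have hzero : ∀ x, (s • p + t • q) x = 0 → p x = 0 ∧ q x = 0 := by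
      intro x hx
      have h1 := mul_nonneg hs.le (hp.1 x)
      have h2 := mul_nonneg ht.le (hq.1 x)
      simp only [Pi.add_apply, Pi.smul_apply, smul_eq_mul] at hx
      exact ⟨(mul_eq_zero.1 (by linarith : s * p x = 0)).resolve_left hs.ne',
        (mul_eq_zero.1 (by linarith : t * q x = 0)).resolve_left ht.ne'⟩
    have h1 := mul_le_mul_of_nonneg_left (hlog p hp fun x hx => (hzero x hx).1) hs.le
    have h2 := mul_le_mul_of_nonneg_left (hlog q hq fun x hx => (hzero x hx).2) ht.le
    refine (add_le_add h1 h2).trans (le_of_eq ?_)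
    rw [← add_mul, hst, one_mul]

lemma trace_convexComb_mul (A B C : Matrix d d ℂ) :
    ((a • A + b • B) * C).trace.re = a * (A * C).trace.re + b * (B * C).trace.re := by
  simp [add_mul, Matrix.trace_add]

lemma gainCapacity_convex {c : ℝ} (hp : p ∈ stdSimplex ℝ X) (hρ : ∀ x, IsState (ρ x))
    (hσ : ∀ x, IsState (σ x)) (hc : 0 < c) (hc1 : c ≤ 1) (ha : 0 ≤ a) (hb : 0 ≤ b) :
    gainCapacity c p (a • ρ + b • σ) ≤ a * gainCapacity c p ρ + b * gainCapacity c p σ := by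
  refine csSup_le (tiltedGains_nonempty hp) ?_
  rintro _ ⟨r, M, h, rfl⟩
  refine le_trans (le_of_eq ?_) (add_le_add
    (mul_le_mul_of_nonneg_left (h.le_gainCapacity hρ hc hc1) ha)
    (mul_le_mul_of_nonneg_left (h.le_gainCapacity hσ hc hc1) hb))
  simp only [tiltedGain, Pi.add_apply, Pi.smul_apply, trace_convexComb_mul, Finset.mul_sum,
    ← Finset.sum_add_distrib]
  exact Finset.sum_congr rfl fun x _ => by ring

/-- For a fixed POVM `logGain` is affine in the states; the terms `log (p x)` recombine because `a +
b = 1`. -/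
lemma logCapacity_convex (hp : p ∈ stdSimplex ℝ X) (hρ : ∀ x, IsState (ρ x))
    (hσ : ∀ x, IsState (σ x)) (ha : 0 ≤ a) (hb : 0 ≤ b) (hab : a + b = 1) :
    logCapacity p (a • ρ + b • σ) ≤ a * logCapacity p ρ + b * logCapacity p σ := by
  refine csSup_le (logGains_nonempty hp) ?_
  rintro _ ⟨M, h, rfl⟩
  refine le_trans (le_of_eq ?_) (add_le_add
    (mul_le_mul_of_nonneg_left (h.le_logCapacity hp hρ) ha)
    (mul_le_mul_of_nonneg_left (h.le_logCapacity hp hσ) hb))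
  simp only [logGain, Pi.add_apply, Pi.smul_apply, trace_convexComb_mul, Finset.mul_sum,
    ← Finset.sum_add_distrib]
  refine Finset.sum_congr rfl fun x _ => ?_
  obtain rfl : b = 1 - a := by linarith
  ring

/-- Quasi-convexity of the maximal leakage in the states. -/
theorem quasiconvexOn_maxLeakage {α : ℝ≥0∞} (hα : 1 ≤ α) (hp : p ∈ stdSimplex ℝ X) :
    QuasiconvexOn ℝ {ρ : X → Matrix d d ℂ | ∀ x, IsState (ρ x)}
      fun ρ => maxLeakage α (cqBlocks p ρ) := by
  rintro t ρ ⟨hρ, hρt⟩ σ ⟨hσ, hσt⟩ a b ha hb hab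
  have hmix : ∀ x, IsState ((a • ρ + b • σ) x) := fun x =>
    isState_convexComb (hρ x) (hσ x) ha hb hab
  refine ⟨hmix, le_trans ?_ (max_le hρt hσt)⟩
  have hmax : ∀ u v : ℝ, a * u + b * v ≤ max u v := fun u v => by
    calc a * u + b * v ≤ a * max u v + b * max u v :=
          add_le_add (mul_le_mul_of_nonneg_left (le_max_left u v) ha)
            (mul_le_mul_of_nonneg_left (le_max_right u v) hb)
      _ = max u v := by rw [← add_mul, hab, one_mul]
  rcases hα.eq_or_lt with rfl | hα
  · simp only [maxLeakage_one_eq_logCapacity hp hρ, maxLeakage_one_eq_logCapacity hp hσ,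
      maxLeakage_one_eq_logCapacity hp hmix]
    rw [← EReal.coe_strictMono.monotone.map_max, EReal.coe_le_coe_iff]
    exact (logCapacity_convex hp hρ hσ ha hb hab).trans (hmax _ _)
  · simp only [maxLeakage_eq_log_gainCapacity hα hp hρ, maxLeakage_eq_log_gainCapacity hα hp hσ,
      maxLeakage_eq_log_gainCapacity hα hp hmix]
    have he := gainExponent_pos hα
    have he1 := gainExponent_le_one hα
    have hle := (gainCapacity_convex hp hρ hσ he he1 ha hb).trans (hmax _ _)
    have hpos := zero_lt_one.trans_le (one_le_gainCapacity hp hmix he he1)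
    rcases le_max_iff.1 hle with h | h
    · exact le_max_of_le_left (EReal.coe_le_coe_iff.2 (mul_le_mul_of_nonneg_left
        (Real.log_le_log hpos h) (inv_nonneg.2 he.le)))
    · exact le_max_of_le_right (EReal.coe_le_coe_iff.2 (mul_le_mul_of_nonneg_left
        (Real.log_le_log hpos h) (inv_nonneg.2 he.le)))

lemma mul_div_rpow_eq {r l : ℝ} (hr : 0 < r) (hl : 0 ≤ l) (a : ℝ) :
    r * (l / r) ^ a = r ^ (1 - a) * l ^ a := by
  rw [Real.div_rpow hl hr.le, Real.rpow_sub hr, Real.rpow_one]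
  have := (Real.rpow_pos_of_pos hr a).ne'
  field_simp

/-- Power means increase with the exponent. -/
lemma IsStrategy.tiltedGain_rpow_le {r : X → ℝ} {M : X → Matrix d d ℂ} (h : IsStrategy p r M)
    (hρ : ∀ x, IsState (ρ x)) (ha : 0 < a) (hab : a < b) (hb : b ≤ 1) :
    tiltedGain a ρ r M ^ (b / a) ≤ tiltedGain b ρ r M := by
  choose w hw hw1 hwf _ using fun x =>
    exists_spectral_weights (hρ x).1 (h.povm.1 x).isHermitian
  set l : X → d → ℝ := fun x => (h.povm.1 x).isHermitian.eigenvalues with hl_def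
  have hl : ∀ x i, 0 ≤ l x i := fun x => (h.povm.1 x).eigenvalues_nonneg
  -- In the eigenbases of the `M x`, the tilted gain is the `a`-th moment of the ratio
  -- (eigenvalue)/`r x` under the probability weights `r x * w x i`.
  have hA : tiltedGain a ρ r M = ∑ y : X × d, r y.1 * w y.1 y.2 * (l y.1 y.2 / r y.1) ^ a := by
    rw [tiltedGain, Fintype.sum_prod_type]
    refine Finset.sum_congr rfl fun x _ => ?_
    rw [hwf, Finset.mul_sum]
    refine Finset.sum_congr rfl fun i _ => ?_
    rcases (h.mem.1 x).eq_or_lt with h0 | h0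
    · rw [← h0, Real.zero_rpow (by linarith)]
      simp
    · rw [mul_right_comm, mul_div_rpow_eq h0 (hl x i)]
      ring
  -- Only an inequality: for `b = 1` an `x` with `r x = 0` contributes to the tilted gain, as `0 ^ 0
  -- = 1`.
  have hB : ∑ y : X × d, r y.1 * w y.1 y.2 * (l y.1 y.2 / r y.1) ^ b ≤ tiltedGain b ρ r M := by
    rw [tiltedGain, Fintype.sum_prod_type]
    refine Finset.sum_le_sum fun x _ => ?_
    rw [hwf, Finset.mul_sum]
    refine Finset.sum_le_sum fun i _ => ?_
    rcases (h.mem.1 x).eq_or_lt with h0 | h0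
    · rw [← h0]
      simp only [zero_mul]
      exact mul_nonneg (Real.rpow_nonneg le_rfl _)
        (mul_nonneg (hw x i) (Real.rpow_nonneg (hl x i) _))
    · rw [mul_right_comm, mul_div_rpow_eq h0 (hl x i)]
      exact le_of_eq (by ring)
  have hsum : ∑ y : X × d, r y.1 * w y.1 y.2 = 1 := by
    rw [Fintype.sum_prod_type]
    simp_rw [← Finset.mul_sum, hw1, fun x => (hρ x).2, Complex.one_re, mul_one]
    exact h.mem.2
  have hnn : ∀ y : X × d, 0 ≤ l y.1 y.2 / r y.1 := fun y => div_nonneg (hl _ _) (h.mem.1 _)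
  have hJ := Real.rpow_arith_mean_le_arith_mean_rpow Finset.univ
    (fun y : X × d => r y.1 * w y.1 y.2) (fun y => (l y.1 y.2 / r y.1) ^ a)
    (fun y _ => mul_nonneg (h.mem.1 _) (hw _ _)) hsum (fun y _ => Real.rpow_nonneg (hnn y) _)
    ((one_le_div ha).2 hab.le)
  rw [hA]
  refine hJ.trans (le_trans (le_of_eq ?_) hB)
  refine Finset.sum_congr rfl fun y _ => ?_
  rw [← Real.rpow_mul (hnn y), mul_div_cancel₀ _ ha.ne']

lemma log_gainCapacity_mono (hp : p ∈ stdSimplex ℝ X) (hρ : ∀ x, IsState (ρ x)) (ha : 0 < a)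
    (hab : a ≤ b) (hb : b ≤ 1) :
    a⁻¹ * Real.log (gainCapacity a p ρ) ≤ b⁻¹ * Real.log (gainCapacity b p ρ) := by
  rcases hab.eq_or_lt with rfl | hab
  · exact le_rfl
  have hb0 : 0 < b := ha.trans hab
  have hCa := one_le_gainCapacity hp hρ ha (hab.le.trans hb)
  have hCb := one_le_gainCapacity hp hρ hb0 hb
  have hle : gainCapacity a p ρ ≤ gainCapacity b p ρ ^ (a / b) := by
    refine csSup_le (tiltedGains_nonempty hp) ?_
    rintro _ ⟨r, M, h, rfl⟩
    have h0 : 0 ≤ tiltedGain a ρ r M := Finset.sum_nonneg fun x _ =>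
      mul_nonneg (Real.rpow_nonneg (h.mem.1 x) _) (trace_mul_rpow_nonneg (hρ x).1 (h.povm.1 x) a)
    have h1 := (h.tiltedGain_rpow_le hρ ha hab hb).trans (h.le_gainCapacity hρ hb0 hb)
    calc tiltedGain a ρ r M = (tiltedGain a ρ r M ^ (b / a)) ^ (a / b) := by
          rw [← Real.rpow_mul h0, div_mul_div_cancel₀ ha.ne', div_self hb0.ne', Real.rpow_one]
      _ ≤ _ := Real.rpow_le_rpow (Real.rpow_nonneg h0 _) h1 (div_nonneg ha.le hb0.le)
  have := Real.log_le_log (zero_lt_one.trans_le hCa) hle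
  rw [Real.log_rpow (zero_lt_one.trans_le hCb)] at this
  have := mul_le_mul_of_nonneg_left this (inv_nonneg.2 ha.le)
  refine this.trans (le_of_eq ?_)
  field_simp

/-- A log-strategy becomes a strategy with `r = p`, and concavity of `log` bounds the mean of the
logarithms of the ratios (eigenvalue)/`p x` by the logarithm of their `a`-th moment. -/
lemma logCapacity_le_log_gainCapacity (hp : p ∈ stdSimplex ℝ X) (hρ : ∀ x, IsState (ρ x))
    (ha : 0 < a) (ha1 : a ≤ 1) :
    logCapacity p ρ ≤ a⁻¹ * Real.log (gainCapacity a p ρ) := by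
  classical
  refine csSup_le (logGains_nonempty hp) ?_
  rintro _ ⟨M, h, rfl⟩
  have hstr : IsStrategy p p M := ⟨hp, h.povm, fun x hx => ⟨hx, h.supp x hx⟩⟩
  rw [← div_eq_inv_mul, le_div_iff₀' ha]
  choose w hw hw1 hwf _ using fun x =>
    exists_spectral_weights (hρ x).1 (h.povm.1 x).isHermitian
  set l : X → d → ℝ := fun x => (h.povm.1 x).isHermitian.eigenvalues with hl_def
  have hl : ∀ x i, 0 ≤ l x i := fun x => (h.povm.1 x).eigenvalues_nonneg
  have hlpos : ∀ x i, p x ≠ 0 → 0 < l x i := fun x i hx => (h.posDef x hx).eigenvalues_pos i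
  have hppos : ∀ x, p x ≠ 0 → 0 < p x := fun x hx => (hp.1 x).lt_of_ne' hx
  have hw1' : ∀ x, ∑ i, w x i = 1 := fun x => by rw [hw1, (hρ x).2, Complex.one_re]
  -- The value `1` off the support of `p` has weight zero and only keeps `z` inside the domain of
  -- concavity of `log`.
  set z : X × d → ℝ := fun y => if p y.1 = 0 then 1 else (l y.1 y.2 / p y.1) ^ a with hz
  have hzpos : ∀ y, z y ∈ Set.Ioi (0 : ℝ) := by
    intro y
    simp only [hz, Set.mem_Ioi]
    split_ifs with h0
    · exact one_pos
    · exact Real.rpow_pos_of_pos (div_pos (hlpos _ _ h0) (hppos _ h0)) _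
  have hsum : ∑ y : X × d, p y.1 * w y.1 y.2 = 1 := by
    rw [Fintype.sum_prod_type]
    simp_rw [← Finset.mul_sum, hw1', mul_one]
    exact hp.2
  have hwnn : ∀ y ∈ (Finset.univ : Finset (X × d)), 0 ≤ p y.1 * w y.1 y.2 := fun y _ =>
    mul_nonneg (hp.1 _) (hw _ _)
  have hJ := strictConcaveOn_log_Ioi.concaveOn.le_map_sum hwnn hsum fun y _ => hzpos y
  have hmem := (convex_Ioi (0 : ℝ)).sum_mem hwnn hsum fun y _ => hzpos y
  simp only [smul_eq_mul] at hJ hmem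
  have hle : ∑ y : X × d, p y.1 * w y.1 y.2 * z y ≤ gainCapacity a p ρ := by
    refine le_trans ?_ (hstr.le_gainCapacity hρ ha ha1)
    rw [tiltedGain, Fintype.sum_prod_type]
    refine Finset.sum_le_sum fun x _ => ?_
    by_cases hx : p x = 0
    · simp only [hx, zero_mul, Finset.sum_const_zero]
      exact mul_nonneg (Real.rpow_nonneg le_rfl _) (trace_mul_rpow_nonneg (hρ x).1 (h.povm.1 x) a)
    · rw [hwf, Finset.mul_sum]
      refine Finset.sum_le_sum fun i _ => ?_
      simp only [hz, if_neg hx]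
      rw [mul_right_comm, mul_div_rpow_eq (hppos x hx) (hl x i)]
      exact le_of_eq (by ring)
  refine le_trans (le_of_eq ?_) (hJ.trans (Real.log_le_log hmem hle))
  rw [logGain, Fintype.sum_prod_type, Finset.mul_sum]
  refine Finset.sum_congr rfl fun x _ => ?_
  by_cases hx : p x = 0
  · simp [hx]
  · rw [hwf]
    calc a * (p x * (∑ i, w x i * Real.log (l x i) - Real.log (p x)))
        = a * (p x * (∑ i, w x i * Real.log (l x i) - ∑ i, w x i * Real.log (p x))) := by
          rw [← Finset.sum_mul, hw1', one_mul]
      _ = _ := by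
          rw [← Finset.sum_sub_distrib, Finset.mul_sum, Finset.mul_sum]
          refine Finset.sum_congr rfl fun i _ => ?_
          simp only [hz, if_neg hx]
          rw [Real.log_rpow (div_pos (hlpos x i hx) (hppos x hx)),
            Real.log_div (hlpos x i hx).ne' hx]
          ring

/-- The maximal leakage increases with the order. -/
theorem monotoneOn_maxLeakage (hp : p ∈ stdSimplex ℝ X) (hρ : ∀ x, IsState (ρ x)) :
    MonotoneOn (fun α : ℝ≥0∞ => maxLeakage α (cqBlocks p ρ)) (Set.Ici 1) := by
  intro α hα β hβ hαβ
  simp only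
  rcases (Set.mem_Ici.1 hα).eq_or_lt with rfl | hα
  · rcases hαβ.eq_or_lt with rfl | hβ
    · exact le_rfl
    · rw [maxLeakage_one_eq_logCapacity hp hρ, maxLeakage_eq_log_gainCapacity hβ hp hρ,
        EReal.coe_le_coe_iff]
      exact logCapacity_le_log_gainCapacity hp hρ (gainExponent_pos hβ) (gainExponent_le_one hβ)
  · have hβ := hα.trans_le hαβ
    rw [maxLeakage_eq_log_gainCapacity hα hp hρ, maxLeakage_eq_log_gainCapacity hβ hp hρ,
      EReal.coe_le_coe_iff]
    exact log_gainCapacity_mono hp hρ (gainExponent_pos hα) (gainExponent_mono hα hαβ)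
      (gainExponent_le_one hβ)

theorem maxLeakage_nonneg {α : ℝ≥0∞} (hα : 1 ≤ α) (hp : p ∈ stdSimplex ℝ X)
    (hρ : ∀ x, IsState (ρ x)) : 0 ≤ maxLeakage α (cqBlocks p ρ) := by
  rcases hα.eq_or_lt with rfl | hα
  · rw [maxLeakage_one_eq_logCapacity hp hρ]
    exact EReal.coe_nonneg.2 (logCapacity_nonneg hp hρ)
  · rw [maxLeakage_eq_log_gainCapacity hα hp hρ]
    exact EReal.coe_nonneg.2 (mul_nonneg (inv_nonneg.2 (gainExponent_pos hα).le)
      (Real.log_nonneg (one_le_gainCapacity hp hρ (gainExponent_pos hα) (gainExponent_le_one hα))))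

theorem maxLeakage_le_log_card {α : ℝ≥0∞} (hα : 1 ≤ α) (hp : p ∈ stdSimplex ℝ X)
    (hρ : ∀ x, IsState (ρ x)) :
    maxLeakage α (cqBlocks p ρ) ≤ ((Real.log (Function.support p).ncard : ℝ) : EReal) := by
  refine (monotoneOn_maxLeakage hp hρ (Set.mem_Ici.2 hα) (Set.mem_Ici.2 le_top) le_top).trans ?_
  simp only
  rw [maxLeakage_eq_log_gainCapacity ENNReal.one_lt_top hp hρ, EReal.coe_le_coe_iff, gainExponent,
    if_pos rfl, inv_one, one_mul]
  refine Real.log_le_log (zero_lt_one.trans_le (one_le_gainCapacity hp hρ one_pos le_rfl)) ?_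
  refine csSup_le (tiltedGains_nonempty hp) ?_
  rintro _ ⟨r, M, h, rfl⟩
  exact h.tiltedGain_le hρ one_pos le_rfl

end Properties

/-! ### Data processing on either side of the Markov chain. -/

section DataProcessing

variable {X S d : Type*} [Fintype X] [Fintype S] [Fintype d] [DecidableEq d]

omit [Fintype d] [DecidableEq d] in
lemma relabel_relabel {T : Type*} (W : X → S → ℝ) (V : S → T → ℝ) (τ : X → Matrix d d ℂ) :
    relabel V (relabel W τ) = relabel (fun x t => ∑ s, W x s * V s t) τ := by
  funext t
  simp only [relabel, Finset.smul_sum, Finset.sum_smul, smul_smul]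
  rw [Finset.sum_comm]
  simp_rw [mul_comm]

lemma maxLeakage_relabel_le (α : ℝ≥0∞) {W : X → S → ℝ} (hW : ∀ x, W x ∈ stdSimplex ℝ S)
    (τ : X → Matrix d d ℂ) : maxLeakage α (relabel W τ) ≤ maxLeakage α τ := by
  refine iSup₂_le fun n V => ?_
  rw [relabel_relabel]
  exact le_iSup_of_le n (le_iSup_of_le
    ⟨fun x t => ∑ s, W x s * V.1 s t, fun x => pushforward_mem (hW x) V.2⟩ le_rfl)

lemma exists_conditional {P : X → S → ℝ} (hP : ∀ x s, 0 ≤ P x s) (hP1 : ∑ x, ∑ s, P x s = 1) :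
    (fun x => ∑ s, P x s) ∈ stdSimplex ℝ X ∧
      ∃ W : X → S → ℝ, (∀ x, W x ∈ stdSimplex ℝ S) ∧ ∀ x s, (∑ t, P x t) * W x s = P x s := by
  classical
  -- On null `x` the conditional distribution is set to the other marginal, which is a probability
  -- vector.
  refine ⟨⟨fun x => Finset.sum_nonneg fun s _ => hP x s, hP1⟩,
    fun x s => if ∑ t, P x t = 0 then ∑ y, P y s else P x s / ∑ t, P x t, fun x => ?_,
    fun x s => ?_⟩
  · by_cases h : ∑ t, P x t = 0
    · simp only [h, if_true]
      exact ⟨fun s => Finset.sum_nonneg fun y _ => hP y s, by rw [Finset.sum_comm]; exact hP1⟩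
    · simp only [h, if_false]
      exact ⟨fun s => div_nonneg (hP x s) (Finset.sum_nonneg fun t _ => hP x t),
        by rw [← Finset.sum_div, div_self h]⟩
  · by_cases h : ∑ t, P x t = 0
    · rw [h, zero_mul]
      exact ((Finset.sum_eq_zero_iff_of_nonneg fun t _ => hP x t).1 h s (Finset.mem_univ s)).symm
    · simp only [h, if_false]
      exact mul_div_cancel₀ _ h

variable [DecidableEq X]

lemma cfc_diagonal (f : ℝ → ℝ) (m : X → ℝ) :
    cfc f (Matrix.diagonal fun x => (m x : ℂ)) = Matrix.diagonal fun x => (f (m x) : ℂ) := by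
  have hsa : (Matrix.diagonal fun x => (m x : ℂ)).IsHermitian :=
    Matrix.isHermitian_diagonal_of_self_adjoint _ (funext fun x => Complex.conj_ofReal _)
  have hfin : (spectrum ℝ (Matrix.diagonal fun x => (m x : ℂ)) ∪ Set.range m).Finite :=
    Matrix.finite_real_spectrum.union (Set.finite_range m)
  set q : Polynomial ℝ := Lagrange.interpolate hfin.toFinset id f
  have hq : ∀ t ∈ spectrum ℝ (Matrix.diagonal fun x => (m x : ℂ)) ∪ Set.range m,
      f t = q.eval t := fun t ht =>
    (Lagrange.eval_interpolate_at_node f (Set.injOn_id _) (hfin.mem_toFinset.2 ht)).symm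
  rw [cfc_congr fun t ht => hq t (Or.inl ht), cfc_polynomial q _ hsa.isSelfAdjoint]
  refine (Polynomial.aeval_algHom_apply (Matrix.diagonalAlgHom ℝ) (fun x => (m x : ℂ)) q).trans ?_
  refine congrArg Matrix.diagonal (funext fun x => ?_)
  rw [hq (m x) (Or.inr ⟨x, rfl⟩)]
  refine (Polynomial.aeval_algHom_apply (Pi.evalAlgHom ℝ (fun _ : X => ℂ) x)
    (fun x => (m x : ℂ)) q).symm.trans ?_
  exact Polynomial.aeval_algebraMap_apply_eq_algebraMap_eval (A := ℂ) (m x) q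

lemma isState_diagonal {v : X → ℝ} (hv : v ∈ stdSimplex ℝ X) :
    IsState (Matrix.diagonal fun x => (v x : ℂ)) := by
  refine ⟨Matrix.PosSemidef.diagonal fun x => Complex.zero_le_real.2 (hv.1 x), ?_⟩
  rw [Matrix.trace_diagonal, ← Complex.ofReal_sum, hv.2, Complex.ofReal_one]

lemma trace_diagonal_mul_cfc (f : ℝ → ℝ) (v m : X → ℝ) :
    ((Matrix.diagonal fun x => (v x : ℂ)) * cfc f (Matrix.diagonal fun x => (m x : ℂ))).trace.re =
      ∑ x, v x * f (m x) := by
  rw [cfc_diagonal, Matrix.diagonal_mul_diagonal, Matrix.trace_diagonal, Complex.re_sum]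
  exact Finset.sum_congr rfl fun x _ => by rw [← Complex.ofReal_mul, Complex.ofReal_re]

variable {σ : X → Matrix d d ℂ} {Q : S → X → ℝ} {p : S → ℝ} {a : ℝ}

omit [Fintype S] [DecidableEq X] [DecidableEq d] in
lemma isState_mixture (hσ : ∀ x, IsState (σ x)) (hQ : ∀ s, Q s ∈ stdSimplex ℝ X) (s : S) :
    IsState (∑ x, Q s x • σ x) := by
  refine ⟨Matrix.posSemidef_sum _ fun x _ => posSemidef_real_smul (hσ x).1 ((hQ s).1 x), ?_⟩
  rw [Matrix.trace_sum]
  simp_rw [Matrix.trace_smul, (hσ _).2, Complex.real_smul, mul_one]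
  rw [← Complex.ofReal_sum, (hQ s).2, Complex.ofReal_one]

omit [Fintype S] [DecidableEq X] in
lemma trace_mixture_mul (s : S) (B : Matrix d d ℂ) :
    ((∑ x, Q s x • σ x) * B).trace.re = ∑ x, Q s x * (σ x * B).trace.re := by
  simp [Finset.sum_mul, Matrix.trace_sum]

/-- The measurement of `X` that a POVM induces through the channel `x ↦ σ x`. -/
lemma IsPOVM.diagonal_trace (hσ : ∀ x, IsState (σ x)) {M : S → Matrix d d ℂ} (hM : IsPOVM M) :
    IsPOVM fun s => Matrix.diagonal fun x => (((σ x * M s).trace.re : ℝ) : ℂ) := by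
  refine ⟨fun s => Matrix.PosSemidef.diagonal fun x =>
    Complex.zero_le_real.2 (trace_mul_nonneg (hσ x).1 (hM.1 s)), ?_⟩
  have : ∑ s, (Matrix.diagonal fun x => (((σ x * M s).trace.re : ℝ) : ℂ)) =
      Matrix.diagonal (∑ s, fun x => (((σ x * M s).trace.re : ℝ) : ℂ)) :=
    (map_sum (Matrix.diagonalAddMonoidHom X ℂ) _ _).symm
  rw [this, ← Matrix.diagonal_one]
  congr 1
  funext x
  rw [Finset.sum_apply, ← Complex.ofReal_sum, ← Complex.re_sum, ← Matrix.trace_sum,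
    ← Finset.mul_sum, hM.2, mul_one, (hσ x).2]
  simp

/-- An observer of `X` can simulate the measurement through the likelihoods `Tr[σ x * M s]`; by
Jensen this does at least as well as the POVM on the output of `σ`. -/
lemma gainCapacity_mixture_le (hp : p ∈ stdSimplex ℝ S) (hσ : ∀ x, IsState (σ x))
    (hQ : ∀ s, Q s ∈ stdSimplex ℝ X) (ha : 0 < a) (ha1 : a ≤ 1) :
    gainCapacity a p (fun s => ∑ x, Q s x • σ x) ≤
      gainCapacity a p fun s => Matrix.diagonal fun x => (Q s x : ℂ) := by
  refine csSup_le (tiltedGains_nonempty hp) ?_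
  rintro _ ⟨r, M, h, rfl⟩
  have h' : IsStrategy p r fun s => Matrix.diagonal fun x => (((σ x * M s).trace.re : ℝ) : ℂ) :=
    ⟨h.mem, h.povm.diagonal_trace hσ, fun s hs =>
      ⟨(h.supp s hs).1, by simp [(h.supp s hs).2]⟩⟩
  refine le_trans ?_ (h'.le_gainCapacity (fun s => isState_diagonal (hQ s)) ha ha1)
  refine Finset.sum_le_sum fun s _ => mul_le_mul_of_nonneg_left ?_ (Real.rpow_nonneg (h.mem.1 s) _)
  rw [trace_mixture_mul, trace_diagonal_mul_cfc]
  exact Finset.sum_le_sum fun x _ => mul_le_mul_of_nonneg_left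
    (trace_mul_rpow_le (hσ x) (h.povm.1 s) ha.le ha1) ((hQ s).1 x)

lemma logCapacity_mixture_le (hp : p ∈ stdSimplex ℝ S) (hσ : ∀ x, IsState (σ x))
    (hQ : ∀ s, Q s ∈ stdSimplex ℝ X) :
    logCapacity p (fun s => ∑ x, Q s x • σ x) ≤
      logCapacity p fun s => Matrix.diagonal fun x => (Q s x : ℂ) := by
  refine csSup_le (logGains_nonempty hp) ?_
  rintro _ ⟨M, h, rfl⟩
  have h' : IsLogStrategy p fun s => Matrix.diagonal fun x => (((σ x * M s).trace.re : ℝ) : ℂ) :=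
    ⟨h.povm.diagonal_trace hσ, fun s hs => by simp [h.supp s hs], fun s hs =>
      Matrix.PosDef.diagonal fun x => Complex.zero_lt_real.2 (trace_mul_pos (hσ x) (h.posDef s hs))⟩
  refine le_trans ?_ (h'.le_logCapacity hp fun s => isState_diagonal (hQ s))
  refine Finset.sum_le_sum fun s _ => ?_
  by_cases hs : p s = 0
  · simp [hs]
  refine mul_le_mul_of_nonneg_left (sub_le_sub_right ?_ _) (hp.1 s)
  rw [trace_mixture_mul, trace_diagonal_mul_cfc]
  exact Finset.sum_le_sum fun x _ => mul_le_mul_of_nonneg_left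
    (trace_mul_log_le (hσ x) (h.posDef s hs)) ((hQ s).1 x)

theorem maxLeakage_mixture_le {α : ℝ≥0∞} (hα : 1 ≤ α) (hp : p ∈ stdSimplex ℝ S)
    (hσ : ∀ x, IsState (σ x)) (hQ : ∀ s, Q s ∈ stdSimplex ℝ X) :
    maxLeakage α (cqBlocks p fun s => ∑ x, Q s x • σ x) ≤
      maxLeakage α (cqBlocks p fun s => Matrix.diagonal fun x => (Q s x : ℂ)) := by
  have h1 := isState_mixture hσ hQ
  have h2 := fun s => isState_diagonal (hQ s)
  rcases hα.eq_or_lt with rfl | hα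
  · rw [maxLeakage_one_eq_logCapacity hp h1, maxLeakage_one_eq_logCapacity hp h2,
      EReal.coe_le_coe_iff]
    exact logCapacity_mixture_le hp hσ hQ
  · have ha := gainExponent_pos hα
    have ha1 := gainExponent_le_one hα
    rw [maxLeakage_eq_log_gainCapacity hα hp h1, maxLeakage_eq_log_gainCapacity hα hp h2,
      EReal.coe_le_coe_iff]
    exact mul_le_mul_of_nonneg_left (Real.log_le_log
      (zero_lt_one.trans_le (one_le_gainCapacity hp h1 ha ha1))
      (gainCapacity_mixture_le hp hσ hQ ha ha1)) (inv_nonneg.2 ha.le)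

end DataProcessing

end QLeakage

theorem mainTheorem5 {X S d : Type*} [Fintype X] [DecidableEq X] [Fintype S]
    [Fintype d] [DecidableEq d] :
    -- (1) concavity in the distribution, for fixed states
    (∀ (α : ℝ≥0∞), 1 ≤ α → ∀ ρ : X → Matrix d d ℂ, (∀ x, QLeakage.IsState (ρ x)) →
      ConcaveOn ℝ (stdSimplex ℝ X)
        (fun p => (QLeakage.maxLeakage α (QLeakage.cqBlocks p ρ)).toReal)) ∧
    -- (2) quasi-convexity in the family of states, for a fixed distribution
    (∀ (α : ℝ≥0∞), 1 ≤ α → ∀ p ∈ stdSimplex ℝ X,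
      QuasiconvexOn ℝ {ρ : X → Matrix d d ℂ | ∀ x, QLeakage.IsState (ρ x)}
        (fun ρ => QLeakage.maxLeakage α (QLeakage.cqBlocks p ρ))) ∧
    -- (3) monotonicity in the order
    (∀ p ∈ stdSimplex ℝ X, ∀ ρ : X → Matrix d d ℂ, (∀ x, QLeakage.IsState (ρ x)) →
      MonotoneOn (fun α : ℝ≥0∞ => QLeakage.maxLeakage α (QLeakage.cqBlocks p ρ)) (Set.Ici 1)) ∧
    -- (4) data processing for the Markov chain `S - X - B` with joint distribution `P` of `(S, X)`
    (∀ (α : ℝ≥0∞), 1 ≤ α → ∀ P ∈ stdSimplex ℝ (S × X),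
      ∀ ρ : X → Matrix d d ℂ, (∀ x, QLeakage.IsState (ρ x)) →
      QLeakage.maxLeakage α (fun s : S => ∑ x, P (s, x) • ρ x) ≤
          QLeakage.maxLeakage α (QLeakage.cqBlocks (fun x => ∑ s, P (s, x)) ρ) ∧
        QLeakage.maxLeakage α (fun s : S => ∑ x, P (s, x) • ρ x) ≤
          QLeakage.maxLeakage α (fun s : S => Matrix.diagonal fun x => (P (s, x) : ℂ))) ∧
    -- (5) bounds
    (∀ p ∈ stdSimplex ℝ X, ∀ ρ : X → Matrix d d ℂ, (∀ x, QLeakage.IsState (ρ x)) →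
      (∀ α : ℝ≥0∞, 1 ≤ α →
        0 ≤ QLeakage.maxLeakage α (QLeakage.cqBlocks p ρ) ∧
        QLeakage.maxLeakage α (QLeakage.cqBlocks p ρ) ≤
          ((Real.log (Function.support p).ncard : ℝ) : EReal)) ∧
      QLeakage.maxLeakage 1 (QLeakage.cqBlocks p ρ) ≤ ((QLeakage.shannonEntropy p : ℝ) : EReal)) := by
  open QLeakage in
  refine ⟨fun α hα ρ hρ => concaveOn_maxLeakage hα hρ,
    fun α hα p hp => quasiconvexOn_maxLeakage hα hp,
    fun p hp ρ hρ => monotoneOn_maxLeakage hp hρ, fun α hα P hP ρ hρ => ⟨?_, ?_⟩,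
    fun p hp ρ hρ => ⟨fun α hα => ⟨maxLeakage_nonneg hα hp hρ, maxLeakage_le_log_card hα hp hρ⟩,
      ?_⟩⟩
  -- Conditioning on `X` exhibits `S` as the output of a channel `W` from `X`.
  · obtain ⟨-, W, hW, hPW⟩ := exists_conditional (P := fun x s => P (s, x)) (fun x s => hP.1 _)
      (by rw [← hP.2, Fintype.sum_prod_type_right])
    have : (fun s : S => ∑ x, P (s, x) • ρ x) =
        relabel W (cqBlocks (fun x => ∑ s, P (s, x)) ρ) := by
      funext s
      refine Finset.sum_congr rfl fun x _ => ?_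
      rw [cqBlocks, smul_smul, mul_comm, hPW]
    rw [this]
    exact maxLeakage_relabel_le α hW _
  -- Conditioning on `S` instead, the states of `B` are mixtures of the `ρ x` with weights `Q s`,
  -- and those of the classical register are the diagonal matrices of `Q s`.
  · obtain ⟨hp, Q, hQ, hPQ⟩ := exists_conditional (P := fun s x => P (s, x)) (fun s x => hP.1 _)
      (by rw [← hP.2, Fintype.sum_prod_type])
    have h1 : (fun s : S => ∑ x, P (s, x) • ρ x) =
        cqBlocks (fun s => ∑ x, P (s, x)) fun s => ∑ x, Q s x • ρ x := by
      funext s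
      rw [cqBlocks, Finset.smul_sum]
      exact Finset.sum_congr rfl fun x _ => by rw [smul_smul, hPQ]
    have h2 : (fun s : S => Matrix.diagonal fun x => (P (s, x) : ℂ)) =
        cqBlocks (fun s => ∑ x, P (s, x)) fun s => Matrix.diagonal fun x => (Q s x : ℂ) := by
      funext s
      rw [cqBlocks, ← Matrix.diagonal_smul]
      congr 1
      funext x
      rw [Pi.smul_apply, Complex.real_smul, ← Complex.ofReal_mul, hPQ]
    rw [h1, h2]
    exact maxLeakage_mixture_le hα hp hρ hQ
  · rw [maxLeakage_one_eq_logCapacity hp hρ, EReal.coe_le_coe_iff]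
    exact logCapacity_le hp hρ
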